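/- Consider a slotted system in which, in each slot $k=1,2,\dots$, independently, a measurement packet arrives ($A_k=1$) with probability $r$ (else $A_k=0$) and joins a first-come-first-served queue. Let $Q_k$ be the queue length at the beginning of slot $k$. If $Q_k=0$ nothing is transmitted ($Y_k=\emptyset$); if $Q_k>0$ the head packet is transmitted, with success ($Y_k=1$) with probability $p$ and failure ($Y_k=0$) with probability $1-p$, independently of everything else, and undelivered packets are retransmitted until delivered, so $Q_{k+1}=(Q_k-\mathbf 1\{Y_k=1\})^++A_k$. Packets are numbered $1,2,\dots$, those initially in the queue coming first, and packet $j$ holds a measurement $X_j$; the $X_j$ are independent of each other and of the arrivals and the channel. Put $D_k=\#\{i\le k: Y_i=1\}$, let $Z_k=X_{D_k}$ if $Y_k=1$ and $Z_k=*$ otherwise, and let $\zeta_k=(Q_k,Y_k,Z_k)$. Let $f_0,f_1$ be probability distributions on a measurable space. Under $\mathbb P_\infty$ (no change), $p=p_0$ and all $X_j\sim f_0$. Under $\mathbb P_0$ (change at time $0$), $p=p_1$, $X_j\sim f_1$ for every packet that arrives in slots $1,2,\dots$ (that is, $j>Q_1$), while the packets in the queue at the start ($j\le Q_1$) hold pre-change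 measurements $X_j\sim f_0$. Let $$\ell_{0,n}=\log\frac{\mathbb P_0(\zeta_1^n\mid Q_1)}{\mathbb P_\infty(\zeta_1^n\mid Q_1)}$$ be the log-likelihood ratio of $\zeta_1,\dots,\zeta_n$ given $Q_1$. Assume $0<r<\min\{p_0,p_1\}$, $p_0,p_1\le 1$, and that the Kullback–Leibler divergences $D(p_1\|p_0)=p_1\log\frac{p_1}{p_0}+(1-p_1)\log\frac{1-p_1}{1-p_0}$ (with $0\log 0=0\log\frac00=0$) and $D(f_1\|f_0)=\mathbb E_{X\sim f_1}\log\frac{f_1(X)}{f_0(X)}$ are finite (the first is finite unless $p_0=1>p_1$). Then the Markov process $\zeta_k$ with success probability $p_1$ and all measurements distributed as $f_1$ has a unique stationary distribution $\Pi$. There is a constant $I$ such that, for every initial queue length $Q_1=q$, $$\frac1n\,\ell_{0,n}\longrightarrow I\qquad \mathbb P_0(\,\cdot\mid Q_1=q)\text{-almost surely as } n\to\infty .$$ Let $L(Q,Y,Z)=\mathbf 1\{Q>0\}\log\frac{P_{p_1}(Y\mid Q>0)}{P_{p_0}(Y\mid Q>0)}+\mathbf 1\{Y=1\}\log\frac{f_1(Z)}{f_0(Z)}$,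 where $P_p(1\mid Q>0)=p$ and $P_p(0\mid Q>0)=1-p$, and write $\mathbb P_0(Q>0)$ for the probability of $Q>0$ under $\Pi$. Then $L$ is $\Pi$-integrable and $$I=\mathbb E_\Pi[L]=\mathbb P_0(Q>0)\bigl(D(p_1\|p_0)+p_1D(f_1\|f_0)\bigr).$$ Moreover $\mathbb P_0(Q>0)=r/p_1$, and hence $$I=r\Bigl(\frac{1}{p_1}D(p_1\|p_0)+D(f_1\|f_0)\Bigr).$$ -/

import Mathlib

open MeasureTheory ProbabilityTheory InformationTheory Filter
open scoped Topology

noncomputable section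

namespace LossyLink

/-- Status of the channel in a slot: no transmission (empty queue), an unsuccessful transmission,
or a successful one. -/
inductive Service : Type
  | idle
  | failed
  | delivered
  deriving DecidableEq

instance : MeasurableSpace Service := ⊤

instance : DiscreteMeasurableSpace Service := ⟨fun _ => trivial⟩

instance : Countable Service :=
  Function.Injective.countable (f := fun y : Service => (decide (y = .idle), decide (y = .failed)))
    (by rintro (_ | _ | _) (_ | _ | _) <;> simp)

/-- Channel status in a slot that begins with `q` queued packets; `c` says whether the channel is
good in that slot, so that an attempted transmission would succeed. -/
def serve (q : ℕ) (c : Bool) : Service :=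
  if q = 0 then .idle else if c then .delivered else .failed

/-- Queue recursion `Q' = (Q - Y)⁺ + A`, where only a delivery counts as `Y = 1`
(natural-number subtraction is the positive part). -/
def nextQueue (q : ℕ) (y : Service) (a : Bool) : ℕ :=
  (q - if y = .delivered then 1 else 0) + if a then 1 else 0

/-- What the decision maker receives in a slot: the measurement `x` if the transmission succeeded,
and the blank symbol `Sum.inr ()` otherwise. -/
def receive {E : Type*} (y : Service) (x : E) : E ⊕ Unit :=
  if y = .delivered then .inl x else .inr ()

/-- Values `(Q, Y, Z)` of the observation in a slot. -/
abbrev Obs (E : Type*) := ℕ × Service × (E ⊕ Unit)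

/-- Elementary outcomes `(A, C, X)`. Slots `1, 2, …` are numbered `0, 1, …` here: `A k` tells
whether a packet arrives in the slot, `C k` whether the channel is good in it. `X j` is the
measurement in packet number `j = 1, 2, …`, where the packets in the queue at the start come
first (`X 0` is not used). -/
abbrev Outcome (E : Type*) := (ℕ → Bool) × (ℕ → Bool) × (ℕ → E)

section Paths

variable {E : Type*}

/-- Queue length at the beginning of each slot, the initial one being `q`. -/
def queueLen (q : ℕ) (ω : Outcome E) : ℕ → ℕ
  | 0 => q
  | k + 1 => nextQueue (queueLen q ω k) (serve (queueLen q ω k) (ω.2.1 k)) (ω.1 k)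

/-- The channel service process `Y`. -/
def service (q : ℕ) (ω : Outcome E) (k : ℕ) : Service :=
  serve (queueLen q ω k) (ω.2.1 k)

/-- Number `D` of the last packet delivered up to and including the slot: delivery is in order,
so this is the number of deliveries so far. -/
def lastDelivered (q : ℕ) (ω : Outcome E) (k : ℕ) : ℕ :=
  ∑ i ∈ Finset.range (k + 1), if service q ω i = .delivered then 1 else 0

/-- The observation `ζ = (Q, Y, Z)` in a slot, with `Z = X_D` on delivery. -/
def zeta (q : ℕ) (ω : Outcome E) (k : ℕ) : Obs E :=
  (queueLen q ω k, service q ω k,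
    receive (service q ω k) (ω.2.2 (lastDelivered q ω k)))

/-- The observations `ζ` in the first `n` slots. -/
def zetaUpTo (q n : ℕ) (ω : Outcome E) : Fin n → Obs E :=
  fun k => zeta q ω k

end Paths

section Law

variable {E : Type*} [MeasurableSpace E]

/-- Law of the system given the initial queue length `q`: all coordinates are independent, arrivals
have probability `r` and good channel slots probability `p`; the packets that are in the
queue at the start hold measurements with distribution `fOld`, all later ones with
distribution `fNew`. -/
def law (q : ℕ) (r p : unitInterval) (fOld fNew : Measure E) : Measure (Outcome E) :=
  (Measure.infinitePi fun _ : ℕ => bernoulliMeasure true false r).prod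
    ((Measure.infinitePi fun _ : ℕ => bernoulliMeasure true false p).prod
      (Measure.infinitePi fun j : ℕ => if j ≤ q then fOld else fNew))

/-- The law without change, given the initial queue length `q`. -/
def lawPre (q : ℕ) (r p₀ : unitInterval) (f₀ : Measure E) : Measure (Outcome E) :=
  law q r p₀ f₀ f₀

/-- The law with change point `0`, given the initial queue length `q`: the packets sampled before
the start still hold pre-change measurements. -/
def lawPost (q : ℕ) (r p₁ : unitInterval) (f₀ f₁ : Measure E) : Measure (Outcome E) :=
  law q r p₁ f₀ f₁

/-- The log-likelihood ratio, of the law with change point `0` versus the law without change, of the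
observations in the first `n` slots, given the initial queue length `q`. -/
def logLikelihood (q : ℕ) (r p₀ p₁ : unitInterval) (f₀ f₁ : Measure E) (n : ℕ)
    (ω : Outcome E) : ℝ :=
  llr ((lawPost q r p₁ f₀ f₁).map (zetaUpTo q n)) ((lawPre q r p₀ f₀).map (zetaUpTo q n))
    (zetaUpTo q n ω)

/-- One step of the observation process: from `(Q, Y, Z)` and fresh arrival, channel state and
measurement to the next observation. -/
def step (t : Obs E × (Bool × Bool × E)) : Obs E :=
  let q' := nextQueue t.1.1 t.1.2.1 t.2.1
  let y' := serve q' t.2.2.1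
  (q', y', receive y' t.2.2.2)

/-- Transition kernel of the Markov process `ζ` when all the measurements in the system have
distribution `g` and the channel has success probability `p`. -/
def transition (r p : unitInterval) (g : Measure E) [IsProbabilityMeasure g] :
    Kernel (Obs E) (Obs E) :=
  (Kernel.id ×ₖ Kernel.const (Obs E)
    ((bernoulliMeasure true false r).prod ((bernoulliMeasure true false p).prod g))).map step

/-- Conditional probability of a channel status given that the queue is not empty. -/
def serviceProb (p : ℝ) : Service → ℝ
  | .idle => 0
  | .failed => 1 - p
  | .delivered => p

/-- The log-likelihood ratio of the observation in a single slot, when any measurement received is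
one that was sampled after the change point. -/
def slotLLR (p₀ p₁ : ℝ) (f₀ f₁ : Measure E) (s : Obs E) : ℝ :=
  (if 0 < s.1 then Real.log (serviceProb p₁ s.2.1 / serviceProb p₀ s.2.1) else 0) +
    Sum.elim (llr f₁ f₀) (fun _ => 0) s.2.2

/-- Kullback-Leibler divergence between the Bernoulli distributions with parameters `p`, `q`. -/
def bernoulliKL (p q : ℝ) : ℝ :=
  p * Real.log (p / q) + (1 - p) * Real.log ((1 - p) / (1 - q))

instance isProbabilityMeasure_law (q : ℕ) (r p : unitInterval) (fOld fNew : Measure E)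
    [IsProbabilityMeasure fOld] [IsProbabilityMeasure fNew] :
    IsProbabilityMeasure (law q r p fOld fNew) := by
  have h : ∀ j : ℕ, IsProbabilityMeasure (if j ≤ q then fOld else fNew) := by
    intro j; split_ifs <;> infer_instance
  unfold law; infer_instance

theorem measurable_receive : Measurable fun t : Service × E => receive t.1 t.2 := by
  refine measurable_from_prod_countable_right fun y => ?_
  cases y <;> simp [receive, measurable_inl]

theorem measurable_step : Measurable (step : Obs E × (Bool × Bool × E) → Obs E) := by
  have hq : Measurable fun t : Obs E × (Bool × Bool × E) =>
      nextQueue t.1.1 t.1.2.1 t.2.1 :=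
    (measurable_of_countable fun u : ℕ × Service × Bool => nextQueue u.1 u.2.1 u.2.2).comp
      (f := fun t : Obs E × (Bool × Bool × E) => (t.1.1, t.1.2.1, t.2.1)) (by fun_prop)
  have hy : Measurable fun t : Obs E × (Bool × Bool × E) =>
      serve (nextQueue t.1.1 t.1.2.1 t.2.1) t.2.2.1 :=
    (measurable_of_countable fun u : ℕ × Bool => serve u.1 u.2).comp
      (hq.prodMk (by fun_prop))
  exact hq.prodMk (hy.prodMk (measurable_receive.comp (hy.prodMk (by fun_prop))))

theorem measurable_queueLen (q k : ℕ) : Measurable fun ω : Outcome E => queueLen q ω k := by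
  induction k with
  | zero => exact measurable_const
  | succ k ih =>
    exact (measurable_of_countable fun u : ℕ × Bool × Bool =>
      nextQueue u.1 (serve u.1 u.2.1) u.2.2).comp
        (ih.prodMk (Measurable.prodMk (by fun_prop) (by fun_prop)))

theorem measurable_service (q k : ℕ) : Measurable fun ω : Outcome E => service q ω k :=
  (measurable_of_countable fun u : ℕ × Bool => serve u.1 u.2).comp
    ((measurable_queueLen q k).prodMk (by fun_prop))

theorem measurable_lastDelivered (q k : ℕ) :
    Measurable fun ω : Outcome E => lastDelivered q ω k := by
  refine Finset.measurable_sum _ fun i _ => ?_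
  exact (measurable_of_countable fun y : Service => if y = .delivered then 1 else 0).comp
    (measurable_service q i)

theorem measurable_zetaUpTo (q n : ℕ) :
    Measurable (zetaUpTo q n : Outcome E → Fin n → Obs E) := by
  refine measurable_pi_lambda _ fun k => ?_
  have hx : Measurable fun ω : Outcome E => ω.2.2 (lastDelivered q ω k) :=
    (measurable_from_prod_countable_right (f := fun t : ℕ × (ℕ → E) => t.2 t.1)
      fun j => measurable_pi_apply j).comp
        ((measurable_lastDelivered q k).prodMk (by fun_prop))
  exact (measurable_queueLen q k).prodMk ((measurable_service q k).prodMk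
    (measurable_receive.comp ((measurable_service q k).prodMk hx)))

end Law

end LossyLink

end

/-! Arrivals have the same law before and after the change, so only the channel and the measurements
contribute to the likelihood ratio. It is the product of the channel-status ratios over the slots
with a nonempty queue and, as delivery is in order, of the measurement ratios `ρ j` of the packets
`1, …, Dₙ`, where `Dₙ` counts deliveries and `ρ j = 1` for `j ≤ q` (`map_zetaUpTo_seqLaw`,
`pathRatio_zetaUpTo`). With `Nₙ` transmissions, the log-likelihood ratio is almost surely `Dₙ log
(p₁/p₀) + (Nₙ - Dₙ) log ((1-p₁)/(1-p₀)) + ∑_{j ≤ Dₙ} log ρ j (X j)`, so the limit needs only three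
rates.

Deliveries: queue length plus `Dₙ` equals `q` plus the arrivals, and the queue is `o(n)` by
comparison with the walk of nonpositive drift `r - p₁`; hence `Dₙ/n → r` (`tendsto_deliveries_div`).
Transmissions: `Dₙ - p₁ Nₙ` is a sum of bounded centred increments and is `o(n)` by exponential
moments (`ae_tendsto_noise_div`); hence `Nₙ/n → r/p₁`. Measurements: the strong law evaluated along
`Dₙ → ∞`, the finitely many old packets being negligible. No ergodic theorem for `ζ` is involved.

On the stationary side, channel state and measurement are fresh in every slot, so an invariant law
of `ζ` is determined by an invariant law of the queue (`bind_transition`). The queue is a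
birth-death chain, whose balance equations reduce to a first-order recursion with a unique
normalized solution giving mass `1 - r/p₁` to `0`. The mean of `slotLLR` then factors by
independence and agrees with the limit. -/

namespace LossyLink

/-! ### Splitting off the first coordinate of an infinite product measure -/

section Sequences

variable {E : Type*} [MeasurableSpace E]

/-- The sequence `x, f 0, f 1, …`. -/
def seqCons {E : Type*} (x : E) (f : ℕ → E) : ℕ → E
  | 0 => x
  | n + 1 => f n

@[simp] theorem seqCons_zero {E : Type*} (x : E) (f : ℕ → E) : seqCons x f 0 = x := rfl

@[simp] theorem seqCons_succ {E : Type*} (x : E) (f : ℕ → E) (n : ℕ) :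
    seqCons x f (n + 1) = f n := rfl

theorem measurable_seqCons : Measurable fun t : E × (ℕ → E) => seqCons t.1 t.2 := by
  refine measurable_pi_lambda _ fun n => ?_
  cases n with
  | zero => exact measurable_fst
  | succ n => exact (measurable_pi_apply n).comp measurable_snd

/-- It suffices to compare the two measures on finite boxes. -/
theorem infinitePi_map_seqCons (g : ℕ → Measure E) [∀ j, IsProbabilityMeasure (g j)] :
    ((g 0).prod (Measure.infinitePi fun j => g (j + 1))).map (fun t => seqCons t.1 t.2) =
      Measure.infinitePi g := by
  classical
  refine Measure.eq_infinitePi _ fun s t ht => ?_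
  obtain ⟨N, hN⟩ : ∃ N, s ⊆ Finset.range (N + 1) :=
    ⟨s.sup id, fun i hi => Finset.mem_range.2 (Nat.lt_succ_of_le (Finset.le_sup (f := id) hi))⟩
  -- Padding with `univ` turns the box over `s` into one over an initial segment of indices, which
  -- splits into its coordinate `0` and the rest.
  let u : ℕ → Set E := fun i => if i ∈ s then t i else Set.univ
  have hu : ∀ i, MeasurableSet (u i) := fun i => by
    by_cases h : i ∈ s
    · simpa [u, h] using ht i
    · simp [u, h]
  have hpre : (fun x : E × (ℕ → E) => seqCons x.1 x.2) ⁻¹' (Set.pi s t) =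
      u 0 ×ˢ Set.pi (Finset.range N : Set ℕ) (fun i => u (i + 1)) := by
    ext ⟨x, f⟩
    simp only [Set.mem_preimage, Set.mem_pi, Set.mem_prod, Finset.mem_coe, Finset.mem_range]
    constructor
    · intro h
      refine ⟨?_, fun i _ => ?_⟩
      · by_cases h0 : 0 ∈ s
        · simpa [u, h0] using h 0 h0
        · simp [u, h0]
      · by_cases h0 : i + 1 ∈ s
        · simpa [u, h0] using h (i + 1) h0
        · simp [u, h0]
    · rintro ⟨h0, h1⟩ i hi
      cases i with
      | zero => simpa [u, hi] using h0
      | succ i =>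
        have := h1 i (by have := Finset.mem_range.1 (hN hi); omega)
        simpa [u, hi] using this
  rw [Measure.map_apply measurable_seqCons (.pi s.countable_toSet fun i _ => ht i), hpre,
    Measure.prod_prod, Measure.infinitePi_pi _ fun i _ => hu (i + 1), mul_comm,
    ← Finset.prod_range_succ' (fun i => g i (u i)) N]
  refine (Finset.prod_subset hN fun i _ hi => by simp [u, hi]).symm.trans
    (Finset.prod_congr rfl fun i hi => by simp [u, hi])

theorem lintegral_infinitePi_seqCons (g : ℕ → Measure E) [∀ j, IsProbabilityMeasure (g j)]
    {F : (ℕ → E) → ENNReal} (hF : Measurable F) :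
    ∫⁻ f, F f ∂(Measure.infinitePi g) =
      ∫⁻ x, ∫⁻ f, F (seqCons x f) ∂(Measure.infinitePi fun j => g (j + 1)) ∂(g 0) := by
  rw [← infinitePi_map_seqCons g, lintegral_map hF measurable_seqCons]
  exact lintegral_prod _ (hF.comp measurable_seqCons).aemeasurable

end Sequences

/-! ### Conditioning on the first slot and on the first measurement -/

section System

variable {E : Type*} [MeasurableSpace E]

/-- The law of independent arrivals, channel states and measurements, the measurement in packet
number `j` having distribution `g j`. -/
noncomputable def seqLaw (r p : unitInterval) (g : ℕ → Measure E) : Measure (Outcome E) :=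
  (Measure.infinitePi fun _ : ℕ => bernoulliMeasure true false r).prod
    ((Measure.infinitePi fun _ : ℕ => bernoulliMeasure true false p).prod (Measure.infinitePi g))

instance isProbabilityMeasure_seqLaw (r p : unitInterval) (g : ℕ → Measure E)
    [∀ j, IsProbabilityMeasure (g j)] : IsProbabilityMeasure (seqLaw r p g) := by
  unfold seqLaw; infer_instance

theorem lintegral_seqLaw (r p : unitInterval) (g : ℕ → Measure E)
    [∀ j, IsProbabilityMeasure (g j)] {F : Outcome E → ENNReal} (hF : Measurable F) :
    ∫⁻ ω, F ω ∂(seqLaw r p g) =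
      ∫⁻ a, ∫⁻ c, ∫⁻ x, F (a, c, x) ∂(Measure.infinitePi g)
        ∂(Measure.infinitePi fun _ : ℕ => bernoulliMeasure true false p)
        ∂(Measure.infinitePi fun _ : ℕ => bernoulliMeasure true false r) := by
  rw [seqLaw, lintegral_prod _ hF.aemeasurable]
  exact lintegral_congr fun a => lintegral_prod _ (hF.comp measurable_prodMk_left).aemeasurable

/-- Conditioning on the arrival and the channel state in the first slot. -/
theorem lintegral_seqLaw_slot (r p : unitInterval) (g : ℕ → Measure E)
    [∀ j, IsProbabilityMeasure (g j)] {F : Outcome E → ENNReal} (hF : Measurable F) :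
    ∫⁻ ω, F ω ∂(seqLaw r p g) =
      ∫⁻ a, ∫⁻ c, ∫⁻ ω, F (seqCons a ω.1, seqCons c ω.2.1, ω.2.2) ∂(seqLaw r p g)
        ∂(bernoulliMeasure true false p) ∂(bernoulliMeasure true false r) := by
  have hG : Measurable fun t : Bool × Bool × Outcome E =>
      F (seqCons t.1 t.2.2.1, seqCons t.2.1 t.2.2.2.1, t.2.2.2.2) := by
    refine hF.comp (Measurable.prodMk ?_ (Measurable.prodMk ?_ (by fun_prop)))
    · exact measurable_seqCons.comp (f := fun t : Bool × Bool × Outcome E => (t.1, t.2.2.1))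
        (by fun_prop)
    · exact measurable_seqCons.comp (f := fun t : Bool × Bool × Outcome E => (t.2.1, t.2.2.2.1))
        (by fun_prop)
  have h1 : Measurable fun t : (ℕ → Bool) × (ℕ → Bool) =>
      ∫⁻ x, F (t.1, t.2, x) ∂(Measure.infinitePi g) :=
    Measurable.lintegral_prod_right' (f := fun t : ((ℕ → Bool) × (ℕ → Bool)) × (ℕ → E) =>
      F (t.1.1, t.1.2, t.2)) (hF.comp (by fun_prop))
  rw [lintegral_seqLaw r p g hF, lintegral_infinitePi_seqCons _ h1.lintegral_prod_right']
  refine lintegral_congr fun a => ?_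
  have h2 : ∀ A : ℕ → Bool, ∫⁻ c, ∫⁻ x, F (seqCons a A, c, x) ∂(Measure.infinitePi g)
        ∂(Measure.infinitePi fun _ : ℕ => bernoulliMeasure true false p) =
      ∫⁻ b, ∫⁻ c, ∫⁻ x, F (seqCons a A, seqCons b c, x) ∂(Measure.infinitePi g)
        ∂(Measure.infinitePi fun _ : ℕ => bernoulliMeasure true false p)
        ∂(bernoulliMeasure true false p) := fun A =>
    lintegral_infinitePi_seqCons _ (h1.comp measurable_prodMk_left)
  simp_rw [h2]
  -- The first channel state is moved outside the integral over the later arrivals.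
  rw [lintegral_lintegral_swap]
  · refine lintegral_congr fun b => ?_
    exact (lintegral_seqLaw r p g (hG.comp (f := fun ω => (a, b, ω)) (by fun_prop))).symm
  · refine Measurable.aemeasurable ?_
    refine Measurable.lintegral_prod_right' (f := fun t : ((ℕ → Bool) × Bool) × (ℕ → Bool) =>
      ∫⁻ x, F (seqCons a t.1.1, seqCons t.1.2 t.2, x) ∂(Measure.infinitePi g)) ?_
    refine Measurable.lintegral_prod_right'
      (f := fun t : (((ℕ → Bool) × Bool) × (ℕ → Bool)) × (ℕ → E) =>
        F (seqCons a t.1.1.1, seqCons t.1.1.2 t.1.2, t.2)) ?_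
    exact hG.comp (f := fun t : (((ℕ → Bool) × Bool) × (ℕ → Bool)) × (ℕ → E) =>
      (a, t.1.1.2, t.1.1.1, t.1.2, t.2)) (by fun_prop)

/-- Splitting off the first measurement. -/
theorem lintegral_seqLaw_measurement (r p : unitInterval) (g : ℕ → Measure E)
    [∀ j, IsProbabilityMeasure (g j)] {F : Outcome E → ENNReal} (hF : Measurable F) :
    ∫⁻ ω, F ω ∂(seqLaw r p g) =
      ∫⁻ x, ∫⁻ ω, F (ω.1, ω.2.1, seqCons x ω.2.2) ∂(seqLaw r p fun j => g (j + 1)) ∂(g 0) := by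
  have hG : Measurable fun t : Outcome E × E => F (t.1.1, t.1.2.1, seqCons t.2 t.1.2.2) := by
    refine hF.comp (Measurable.prodMk (by fun_prop) (Measurable.prodMk (by fun_prop) ?_))
    exact measurable_seqCons.comp (f := fun t : Outcome E × E => (t.2, t.1.2.2)) (by fun_prop)
  have hswap := lintegral_lintegral_swap (μ := seqLaw r p fun j => g (j + 1)) (ν := g 0)
    (f := fun ω x => F (ω.1, ω.2.1, seqCons x ω.2.2)) hG.aemeasurable
  rw [← hswap, lintegral_seqLaw r p g hF,
    lintegral_seqLaw r p _ (F := fun ω => ∫⁻ x, F (ω.1, ω.2.1, seqCons x ω.2.2) ∂(g 0))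
      hG.lintegral_prod_right']
  refine lintegral_congr fun a => lintegral_congr fun c => ?_
  rw [lintegral_infinitePi_seqCons g (F := fun x => F (a, c, x)) (hF.comp (by fun_prop)),
    lintegral_lintegral_swap]
  exact (hG.comp (f := fun t : E × (ℕ → E) => ((a, c, t.2), t.1)) (by fun_prop)).aemeasurable

end System

/-! ### The system restarted at the second slot -/

section Shift

variable {E : Type*}

/-- The outcome as seen from the second slot on, a packet delivered in the first slot being
dropped. -/
def shift (q : ℕ) (ω : Outcome E) : Outcome E :=
  (fun k => ω.1 (k + 1), fun k => ω.2.1 (k + 1),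
    fun j => ω.2.2 (j + if service q ω 0 = .delivered then 1 else 0))

theorem queueLen_shift (q : ℕ) (ω : Outcome E) (k : ℕ) :
    queueLen (queueLen q ω 1) (shift q ω) k = queueLen q ω (k + 1) := by
  induction k with
  | zero => rfl
  | succ k ih => rw [queueLen, ih]; rfl

theorem service_shift (q : ℕ) (ω : Outcome E) (k : ℕ) :
    service (queueLen q ω 1) (shift q ω) k = service q ω (k + 1) := by
  rw [service, queueLen_shift]; rfl

theorem lastDelivered_shift (q : ℕ) (ω : Outcome E) (k : ℕ) :
    lastDelivered (queueLen q ω 1) (shift q ω) k + (if service q ω 0 = .delivered then 1 else 0) =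
      lastDelivered q ω (k + 1) := by
  rw [lastDelivered, lastDelivered, Finset.sum_range_succ' _ (k + 1)]
  simp_rw [service_shift]

theorem zeta_shift (q : ℕ) (ω : Outcome E) (k : ℕ) :
    zeta (queueLen q ω 1) (shift q ω) k = zeta q ω (k + 1) := by
  simp only [zeta, queueLen_shift, service_shift, ← lastDelivered_shift q ω k]
  rfl

theorem zetaUpTo_succ (q n : ℕ) (ω : Outcome E) :
    zetaUpTo q (n + 1) ω =
      Fin.cons (zeta q ω 0) (zetaUpTo (queueLen q ω 1) n (shift q ω)) := by
  funext k
  refine Fin.cases rfl (fun i => ?_) k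
  rw [Fin.cons_succ]
  exact (zeta_shift q ω i).symm

theorem queueLen_congr {q : ℕ} {ω ω' : Outcome E} (h₁ : ω.1 = ω'.1) (h₂ : ω.2.1 = ω'.2.1) (k : ℕ) :
    queueLen q ω k = queueLen q ω' k := by
  induction k with
  | zero => rfl
  | succ k ih => rw [queueLen, queueLen, ih, h₁, h₂]

theorem lastDelivered_pos {q : ℕ} {ω : Outcome E} {k : ℕ} (h : service q ω k = .delivered) :
    1 ≤ lastDelivered q ω k := by
  rw [lastDelivered, Finset.sum_range_succ, if_pos h]
  omega

/-- The measurement number `0` is not used. -/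
theorem zetaUpTo_seqCons (q n : ℕ) (a c : ℕ → Bool) (x y : E) (f : ℕ → E) :
    zetaUpTo q n (a, c, seqCons x f) = zetaUpTo q n (a, c, seqCons y f) := by
  have hq : ∀ k, queueLen q (a, c, seqCons x f) k = queueLen q (a, c, seqCons y f) k :=
    queueLen_congr rfl rfl
  have hs : ∀ k, service q (a, c, seqCons x f) k = service q (a, c, seqCons y f) k := fun k => by
    rw [service, service, hq]
  have hd : ∀ k, lastDelivered q (a, c, seqCons x f) k = lastDelivered q (a, c, seqCons y f) k :=
    fun k => by simp only [lastDelivered, hs]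
  funext k
  simp only [zetaUpTo, zeta, hq, hs, hd]
  by_cases h : service q (a, c, seqCons y f) k = .delivered
  · obtain ⟨d, hd'⟩ := Nat.exists_eq_add_of_le' (lastDelivered_pos h)
    rw [hd', seqCons_succ, seqCons_succ]
  · simp [receive, h]

theorem zetaUpTo_succ_of_ne (q n : ℕ) (a c : Bool) (ω : Outcome E) (h : serve q c ≠ .delivered) :
    zetaUpTo q (n + 1) (seqCons a ω.1, seqCons c ω.2.1, ω.2.2) =
      Fin.cons (q, serve q c, .inr ()) (zetaUpTo (nextQueue q (serve q c) a) n ω) := by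
  rw [zetaUpTo_succ]
  simp [zeta, service, queueLen, receive, h, shift]

theorem zetaUpTo_succ_of_eq (q n : ℕ) (a c : Bool) (x y : E) (ω : Outcome E)
    (h : serve q c = .delivered) :
    zetaUpTo q (n + 1) (seqCons a ω.1, seqCons c ω.2.1, seqCons x (seqCons y ω.2.2)) =
      Fin.cons (q, serve q c, .inl y)
        (zetaUpTo (nextQueue q (serve q c) a) n (ω.1, ω.2.1, seqCons y ω.2.2)) := by
  rw [zetaUpTo_succ]
  simp [zeta, service, queueLen, receive, h, shift, lastDelivered]

end Shift

/-! ### Density of the observations by recursion on the slots -/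

section Ratio

/-- Likelihood ratio of a channel status given the queue length. -/
noncomputable def slotRatio (p₀ p₁ : ℝ) (q : ℕ) (y : Service) : ENNReal :=
  if 0 < q then ENNReal.ofReal (serviceProb p₁ y / serviceProb p₀ y) else 1

/-- Likelihood ratio of the observations in the first `n` slots when the measurement in packet
number `j` has likelihood ratio `ρ j`. -/
noncomputable def pathRatio {E : Type*} (p₀ p₁ : ℝ) :
    (n : ℕ) → (ℕ → E → ENNReal) → (Fin n → Obs E) → ENNReal
  | 0, _, _ => 1
  | n + 1, ρ, z => slotRatio p₀ p₁ (z 0).1 (z 0).2.1 *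
      if (z 0).2.1 = .delivered then
        Sum.elim (ρ 1) (fun _ => 1) (z 0).2.2 *
          pathRatio p₀ p₁ n (fun j => ρ (j + 1)) (fun i => z i.succ)
      else pathRatio p₀ p₁ n ρ (fun i => z i.succ)

theorem pathRatio_succ {E : Type*} (p₀ p₁ : ℝ) (n : ℕ) (ρ : ℕ → E → ENNReal) (z : Fin (n + 1) → Obs E) :
    pathRatio p₀ p₁ (n + 1) ρ z = slotRatio p₀ p₁ (z 0).1 (z 0).2.1 *
      if (z 0).2.1 = .delivered then
        Sum.elim (ρ 1) (fun _ => 1) (z 0).2.2 *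
          pathRatio p₀ p₁ n (fun j => ρ (j + 1)) (fun i => z i.succ)
      else pathRatio p₀ p₁ n ρ (fun i => z i.succ) := rfl

variable {E : Type*} [MeasurableSpace E]

theorem measurable_pathRatio (p₀ p₁ : ℝ) (n : ℕ) {ρ : ℕ → E → ENNReal}
    (hρ : ∀ j, Measurable (ρ j)) : Measurable (pathRatio p₀ p₁ n ρ) := by
  induction n generalizing ρ with
  | zero => exact measurable_const
  | succ n ih =>
    have htail : Measurable fun (z : Fin (n + 1) → Obs E) (i : Fin n) => z i.succ := by fun_prop
    have h0 : Measurable fun z : Fin (n + 1) → Obs E => z 0 := by fun_prop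
    simp only [funext (pathRatio_succ p₀ p₁ n ρ)]
    refine Measurable.mul ?_ (Measurable.ite ?_ (Measurable.mul ?_ ?_) ?_)
    · exact (measurable_of_countable fun u : ℕ × Service => slotRatio p₀ p₁ u.1 u.2).comp
        (f := fun z : Fin (n + 1) → Obs E => ((z 0).1, (z 0).2.1)) (by fun_prop)
    · exact (h0.snd.fst) (MeasurableSet.of_discrete (s := {Service.delivered}))
    · exact ((hρ 1).sumElim measurable_const).comp h0.snd.snd
    · exact (ih fun j => hρ (j + 1)).comp htail
    · exact (ih hρ).comp htail

theorem lintegral_bernoulliMeasure (p : unitInterval) (f : Bool → ENNReal) :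
    ∫⁻ c, f c ∂(bernoulliMeasure true false p) =
      ENNReal.ofReal p * f true + ENNReal.ofReal (1 - p) * f false := by
  rw [bernoulliMeasure_def, lintegral_add_measure, lintegral_smul_measure, lintegral_smul_measure,
    lintegral_dirac, lintegral_dirac]
  congr 1
  · rw [ENNReal.smul_def, smul_eq_mul]; congr 1
    rw [ENNReal.ofReal, Real.toNNReal_of_nonneg p.2.1]; rfl
  · rw [ENNReal.smul_def, smul_eq_mul]; congr 1
    rw [ENNReal.ofReal, Real.toNNReal_of_nonneg (unitInterval.one_minus_nonneg p)]; rfl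

/-- Change of measure for the channel in one slot: an empty queue gives the same status under both
laws, and otherwise the two Bernoulli weights are reweighted separately. -/
theorem lintegral_serve_eq_slotRatio {p₀ p₁ : unitInterval} (h0 : 0 < (p₀ : ℝ))
    (hp : (p₀ : ℝ) < 1 ∨ (p₁ : ℝ) = 1) (q : ℕ) (f : Service → ENNReal) :
    ∫⁻ c, f (serve q c) ∂(bernoulliMeasure true false p₁) =
      ∫⁻ c, slotRatio p₀ p₁ q (serve q c) * f (serve q c)
        ∂(bernoulliMeasure true false p₀) := by
  rcases Nat.eq_zero_or_pos q with rfl | hq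
  · simp [serve, slotRatio]
  · have hne : q ≠ 0 := hq.ne'
    rw [lintegral_bernoulliMeasure, lintegral_bernoulliMeasure]
    simp only [serve, hne, if_false, if_true, slotRatio, hq, serviceProb, ← mul_assoc,
      Bool.false_eq_true]
    rw [← ENNReal.ofReal_mul h0.le, ← ENNReal.ofReal_mul (unitInterval.one_minus_nonneg p₀),
      mul_div_cancel₀ _ h0.ne']
    congr 3
    -- If `p₁ = 1`, a failure has weight `0` on both sides, also when `p₀ = 1` and the quotient is
    -- `0 / 0 = 0`.
    rcases hp with hp | hp
    · rw [mul_div_cancel₀ _ (by linarith)]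
    · simp [hp]

/-- Contribution of a first slot with channel status `y` and arrival `a` to an expectation of the
observations in the first `n + 1` slots. -/
noncomputable def slotLIntegral (r p : unitInterval) (g : ℕ → Measure E) (q n : ℕ)
    (φ : (Fin (n + 1) → Obs E) → ENNReal) (a : Bool) (y : Service) : ENNReal :=
  if y = .delivered then
    ∫⁻ x, ∫⁻ ω, φ (Fin.cons (q, y, .inl x) (zetaUpTo (nextQueue q y a) n ω))
      ∂(seqLaw r p fun j => g (j + 1)) ∂(g 1)
  else ∫⁻ ω, φ (Fin.cons (q, y, .inr ()) (zetaUpTo (nextQueue q y a) n ω)) ∂(seqLaw r p g)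

theorem measurable_cons {n : ℕ} {α : Type*} [MeasurableSpace α] {f : α → Obs E}
    {z : α → Fin n → Obs E} (hf : Measurable f) (hz : Measurable z) :
    Measurable fun t => (Fin.cons (f t) (z t) : Fin (n + 1) → Obs E) := by
  refine measurable_pi_lambda _ fun k => ?_
  refine Fin.cases ?_ (fun i => ?_) k
  · simpa using hf
  · simpa using (measurable_pi_iff.1 hz) i

theorem lintegral_zetaUpTo_succ (r p : unitInterval) (g : ℕ → Measure E)
    [∀ j, IsProbabilityMeasure (g j)] (q n : ℕ) {φ : (Fin (n + 1) → Obs E) → ENNReal}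
    (hφ : Measurable φ) :
    ∫⁻ ω, φ (zetaUpTo q (n + 1) ω) ∂(seqLaw r p g) =
      ∫⁻ a, ∫⁻ c, slotLIntegral r p g q n φ a (serve q c)
        ∂(bernoulliMeasure true false p) ∂(bernoulliMeasure true false r) := by
  rw [lintegral_seqLaw_slot r p g (F := fun ω => φ (zetaUpTo q (n + 1) ω))
    (hφ.comp (measurable_zetaUpTo q (n + 1)))]
  refine lintegral_congr fun a => lintegral_congr fun c => ?_
  by_cases h : serve q c = .delivered
  · have hF : Measurable fun ω : Outcome E =>
        φ (zetaUpTo q (n + 1) (seqCons a ω.1, seqCons c ω.2.1, ω.2.2)) := by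
      refine hφ.comp ((measurable_zetaUpTo q (n + 1)).comp (Measurable.prodMk ?_
        (Measurable.prodMk ?_ (by fun_prop))))
      · exact measurable_seqCons.comp (f := fun ω : Outcome E => (a, ω.1)) (by fun_prop)
      · exact measurable_seqCons.comp (f := fun ω : Outcome E => (c, ω.2.1)) (by fun_prop)
    have hF' : ∀ x : E, Measurable fun ω : Outcome E =>
        φ (zetaUpTo q (n + 1) (seqCons a ω.1, seqCons c ω.2.1, seqCons x ω.2.2)) := fun x =>
      hF.comp (f := fun ω : Outcome E => (ω.1, ω.2.1, seqCons x ω.2.2))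
        (Measurable.prodMk (by fun_prop) (Measurable.prodMk (by fun_prop)
          (measurable_seqCons.comp (f := fun ω : Outcome E => (x, ω.2.2)) (by fun_prop))))
    rw [lintegral_seqLaw_measurement r p g hF, slotLIntegral, if_pos h]
    simp_rw [fun x : E => lintegral_seqLaw_measurement r p (fun j => g (j + 1)) (hF' x)]
    simp_rw [zetaUpTo_succ_of_eq q n a c _ _ _ h, lintegral_const, measure_univ, mul_one]
    refine lintegral_congr fun x => ?_
    rw [lintegral_seqLaw_measurement r p (fun j => g (j + 1)) (F := fun ω =>
      φ (Fin.cons (q, serve q c, .inl x) (zetaUpTo (nextQueue q (serve q c) a) n ω)))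
      (hφ.comp (measurable_cons measurable_const (measurable_zetaUpTo _ n)))]
    -- After a delivery the received packet carries number `0` in the shifted system, where it is
    -- never read. It can therefore be replaced by an independent copy `y`, which makes the
    -- remaining system independent of the received `x`.
    have hconst : ∀ (y : E) (ω : Outcome E),
        zetaUpTo (nextQueue q (serve q c) a) n (ω.1, ω.2.1, seqCons y ω.2.2) =
          zetaUpTo (nextQueue q (serve q c) a) n (ω.1, ω.2.1, seqCons x ω.2.2) :=
      fun y ω => zetaUpTo_seqCons _ n _ _ y x ω.2.2
    refine Eq.trans ?_ (lintegral_congr fun y => lintegral_congr fun ω => by rw [hconst y ω])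
    rw [lintegral_const, measure_univ, mul_one]
  · rw [slotLIntegral, if_neg h]
    simp_rw [zetaUpTo_succ_of_ne q n a c _ h]

/-- Change of measure for the observations in the first `n` slots. -/
theorem lintegral_zetaUpTo {r p₀ p₁ : unitInterval} (h0 : 0 < (p₀ : ℝ))
    (hp : (p₀ : ℝ) < 1 ∨ (p₁ : ℝ) = 1) (n : ℕ) (e g : ℕ → Measure E)
    [∀ j, IsProbabilityMeasure (e j)] [∀ j, IsProbabilityMeasure (g j)] {ρ : ℕ → E → ENNReal}
    (hρ : ∀ j, Measurable (ρ j)) (hg : ∀ j, g j = (e j).withDensity (ρ j)) (q : ℕ)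
    {φ : (Fin n → Obs E) → ENNReal} (hφ : Measurable φ) :
    ∫⁻ ω, φ (zetaUpTo q n ω) ∂(seqLaw r p₁ g) =
      ∫⁻ ω, pathRatio p₀ p₁ n ρ (zetaUpTo q n ω) * φ (zetaUpTo q n ω) ∂(seqLaw r p₀ e) := by
  induction n generalizing e g ρ q with
  | zero =>
    have : ∀ ω : Outcome E, zetaUpTo q 0 ω = Fin.elim0 := fun ω => Subsingleton.elim _ _
    simp [this, pathRatio]
  | succ n ih =>
    rw [lintegral_zetaUpTo_succ r p₁ g q n hφ, lintegral_zetaUpTo_succ r p₀ e q n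
      (φ := fun z => pathRatio p₀ p₁ (n + 1) ρ z * φ z)
      ((measurable_pathRatio _ _ _ hρ).mul hφ)]
    -- The arrival has the same law on both sides; only the channel state, the delivered measurement
    -- and the remaining slots need reweighting.
    refine lintegral_congr fun a => ?_
    rw [lintegral_serve_eq_slotRatio h0 hp q (slotLIntegral r p₁ g q n φ a)]
    refine lintegral_congr fun c => ?_
    generalize serve q c = y
    have hm : ∀ o : Obs E, Measurable fun z : Fin n → Obs E => φ (Fin.cons o z) := fun o =>
      hφ.comp (measurable_cons measurable_const measurable_id)
    by_cases h : y = .delivered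
    · simp only [slotLIntegral, if_pos h, pathRatio, Fin.cons_zero, Fin.cons_succ, Sum.elim_inl]
      have hρ' : ∀ j, Measurable (ρ (j + 1)) := fun j => hρ (j + 1)
      have hJ : Measurable fun t : E × Outcome E =>
          pathRatio p₀ p₁ n (fun j => ρ (j + 1)) (zetaUpTo (nextQueue q y a) n t.2) *
            φ (Fin.cons (q, y, .inl t.1) (zetaUpTo (nextQueue q y a) n t.2)) := by
        refine (((measurable_pathRatio p₀ p₁ n hρ').comp (measurable_zetaUpTo _ n)).comp
          measurable_snd).mul (hφ.comp (measurable_cons ?_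
            ((measurable_zetaUpTo _ n).comp measurable_snd)))
        exact measurable_const.prodMk (measurable_const.prodMk
          (measurable_inl.comp measurable_fst))
      simp_rw [fun x : E => ih (fun j => e (j + 1)) (fun j => g (j + 1)) hρ' (fun j => hg (j + 1))
        (nextQueue q y a) (hm (q, y, .inl x))]
      rw [hg 1, lintegral_withDensity_eq_lintegral_mul _ (hρ 1) hJ.lintegral_prod_right',
        ← lintegral_const_mul _ ((hρ 1).mul hJ.lintegral_prod_right')]
      refine lintegral_congr fun x => ?_
      have hx := lintegral_const_mul (μ := seqLaw r p₀ fun j => e (j + 1))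
        (slotRatio p₀ p₁ q y * ρ 1 x) (hJ.comp (measurable_prodMk_left (x := x)))
      rw [Pi.mul_apply, ← mul_assoc]
      refine hx.symm.trans (lintegral_congr fun ω => ?_)
      simp only [Function.comp_apply, mul_assoc]
    · simp only [slotLIntegral, if_neg h, pathRatio, Fin.cons_zero, Fin.cons_succ]
      rw [ih e g hρ hg (nextQueue q y a) (hm (q, y, .inr ())), ← lintegral_const_mul]
      · exact lintegral_congr fun ω => (mul_assoc _ _ _).symm
      · exact ((measurable_pathRatio p₀ p₁ n hρ).comp (measurable_zetaUpTo _ n)).mul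
          ((hm _).comp (measurable_zetaUpTo _ n))

/-- Law of the observations in the first `n` slots as a measure with density. -/
theorem map_zetaUpTo_seqLaw {r p₀ p₁ : unitInterval} (h0 : 0 < (p₀ : ℝ))
    (hp : (p₀ : ℝ) < 1 ∨ (p₁ : ℝ) = 1) (n : ℕ) (e g : ℕ → Measure E)
    [∀ j, IsProbabilityMeasure (e j)] [∀ j, IsProbabilityMeasure (g j)] {ρ : ℕ → E → ENNReal}
    (hρ : ∀ j, Measurable (ρ j)) (hg : ∀ j, g j = (e j).withDensity (ρ j)) (q : ℕ) :
    (seqLaw r p₁ g).map (zetaUpTo q n) =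
      ((seqLaw r p₀ e).map (zetaUpTo q n)).withDensity (pathRatio p₀ p₁ n ρ) := by
  have hz := measurable_zetaUpTo (E := E) q n
  have hr := measurable_pathRatio p₀ p₁ n hρ
  refine Measure.ext_of_lintegral _ fun φ hφ => ?_
  rw [lintegral_map hφ hz, lintegral_withDensity_eq_lintegral_mul _ hr hφ,
    lintegral_map (hr.mul hφ) hz]
  exact lintegral_zetaUpTo h0 hp n e g hρ hg q hφ

end Ratio

/-! ### Deliveries, transmissions and the growth of the queue along a path -/

section Counting

variable {E : Type*}

/-- Number of deliveries in the first `n` slots. -/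
def deliveries (q : ℕ) (ω : Outcome E) (n : ℕ) : ℕ :=
  ∑ i ∈ Finset.range n, if service q ω i = .delivered then 1 else 0

/-- Number of transmissions in the first `n` slots. -/
def transmissions (q : ℕ) (ω : Outcome E) (n : ℕ) : ℕ :=
  ∑ i ∈ Finset.range n, if 0 < queueLen q ω i then 1 else 0

theorem deliveries_shift (q : ℕ) (ω : Outcome E) (n : ℕ) :
    deliveries (queueLen q ω 1) (shift q ω) n + (if service q ω 0 = .delivered then 1 else 0) =
      deliveries q ω (n + 1) := by
  rw [deliveries, deliveries, Finset.sum_range_succ' _ n]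
  simp_rw [service_shift]

/-- Delivery is in order, so the measurements seen are exactly those of the first `deliveries q ω n`
packets; each delivery in the recursion renumbers the ratios by one. -/
theorem pathRatio_zetaUpTo (p₀ p₁ : ℝ) (n q : ℕ) (ρ : ℕ → E → ENNReal) (ω : Outcome E) :
    pathRatio p₀ p₁ n ρ (zetaUpTo q n ω) =
      (∏ k ∈ Finset.range n, slotRatio p₀ p₁ (queueLen q ω k) (service q ω k)) *
        ∏ j ∈ Finset.range (deliveries q ω n), ρ (j + 1) (ω.2.2 (j + 1)) := by
  induction n generalizing q ρ ω with
  | zero => simp [pathRatio, deliveries]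
  | succ n ih =>
    rw [zetaUpTo_succ, pathRatio_succ]
    simp only [Fin.cons_zero, Fin.cons_succ, ih, queueLen_shift, service_shift]
    rw [Finset.prod_range_succ' _ n, ← deliveries_shift q ω n]
    by_cases h : service q ω 0 = .delivered
    · simp only [zeta, h, if_true, receive, Sum.elim_inl, lastDelivered, Finset.sum_range_succ,
        Finset.sum_range_zero, zero_add, shift, Finset.prod_range_succ']
      ring
    · simp only [zeta, h, if_false, shift, add_zero]
      ring

/-- Conservation of packets; an empty queue delivers nothing, so the positive part in the recursion
never discards anything. -/
theorem queueLen_add_deliveries (q : ℕ) (ω : Outcome E) (n : ℕ) :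
    queueLen q ω n + deliveries q ω n =
      q + ∑ k ∈ Finset.range n, if ω.1 k then 1 else 0 := by
  induction n with
  | zero => simp [queueLen, deliveries]
  | succ n ih =>
    have hstep : queueLen q ω (n + 1) + (if service q ω n = .delivered then 1 else 0) =
        queueLen q ω n + if ω.1 n then 1 else 0 := by
      rw [queueLen, service, nextQueue]
      rcases Nat.eq_zero_or_pos (queueLen q ω n) with h | h
      · simp [h, serve]
      · cases ω.2.1 n <;> simp [serve, h.ne']; omega
    rw [deliveries, Finset.sum_range_succ, Finset.sum_range_succ, ← add_assoc q, ← ih, deliveries]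
    omega

/-- Comparison of the queue with its free process. -/
theorem queueLen_le (q : ℕ) (ω : Outcome E) {δ B : ℝ} (hδ : δ ≤ 0) {N : ℕ}
    (hB : ∀ n ≤ N, |(∑ k ∈ Finset.range n,
      ((if ω.1 k then 1 else 0) - (if ω.2.1 k then 1 else 0) : ℝ)) - n * δ| ≤ B) :
    (queueLen q ω N : ℝ) ≤ 2 * B + q + 1 := by
  -- Write `T` for the free walk. As `T n - n δ + B ≥ 0`, the bound holds again whenever the queue
  -- was just empty, since its next length is at most `1`. While busy the queue has the increments
  -- of `T`, and `-δ ≥ 0` only enlarges the bound.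
  suffices H : ∀ n ≤ N, (queueLen q ω n : ℝ) ≤ (∑ k ∈ Finset.range n,
      ((if ω.1 k then 1 else 0) - (if ω.2.1 k then 1 else 0) : ℝ)) - n * δ + B + q + 1 by
    have h1 := H N le_rfl
    have h2 := (abs_le.1 (hB N le_rfl)).2
    linarith
  intro n
  induction n with
  | zero =>
    intro h
    have := (abs_nonneg _).trans (hB 0 h)
    simp only [queueLen, Finset.range_zero, Finset.sum_empty, Nat.cast_zero]
    linarith
  | succ n ih =>
    intro h
    have h1 := ih (by omega)
    have h2 := (abs_le.1 (hB (n + 1) h)).1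
    rw [Finset.sum_range_succ] at h2 ⊢
    push_cast at h2 ⊢
    have hq : (0 : ℝ) ≤ q := q.cast_nonneg
    rcases Nat.eq_zero_or_pos (queueLen q ω n) with h0 | h0
    · have : queueLen q ω (n + 1) ≤ 1 := by
        rw [queueLen, h0, nextQueue]; split_ifs <;> simp
      have : (queueLen q ω (n + 1) : ℝ) ≤ 1 := by exact_mod_cast this
      linarith
    · have : (queueLen q ω (n + 1) : ℝ) = queueLen q ω n +
          ((if ω.1 n then 1 else 0) - (if ω.2.1 n then 1 else 0) : ℝ) := by
        rw [queueLen, nextQueue, serve, if_neg h0.ne']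
        have h1 : 1 ≤ queueLen q ω n := h0
        cases ω.2.1 n <;> cases ω.1 n <;> simp [Nat.cast_sub h1, sub_eq_add_neg]
      linarith

/-- Convergence of the averages bounds the deviation of the free walk from its drift by `n ε / 4 +
K` for all `n`. This bound increases with `n`, so it serves as the uniform `B` of `queueLen_le`;
zero drift is allowed. -/
theorem tendsto_queueLen_div (q : ℕ) (ω : Outcome E) {α β : ℝ} (h : α ≤ β)
    (hA : Tendsto (fun n : ℕ => (∑ k ∈ Finset.range n, (if ω.1 k then 1 else 0 : ℝ)) / n) atTop
      (𝓝 α))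
    (hC : Tendsto (fun n : ℕ => (∑ k ∈ Finset.range n, (if ω.2.1 k then 1 else 0 : ℝ)) / n) atTop
      (𝓝 β)) :
    Tendsto (fun n : ℕ => (queueLen q ω n : ℝ) / n) atTop (𝓝 0) := by
  set T : ℕ → ℝ := fun n => ∑ k ∈ Finset.range n,
      ((if ω.1 k then 1 else 0) - (if ω.2.1 k then 1 else 0) : ℝ) with hT
  have hTlim : Tendsto (fun n : ℕ => T n / n) atTop (𝓝 (α - β)) := by
    refine (hA.sub hC).congr fun n => ?_
    simp only [hT, Finset.sum_sub_distrib, sub_div]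
  rw [Metric.tendsto_atTop]
  intro ε hε
  obtain ⟨N₀, hN₀⟩ := Metric.tendsto_atTop.1 hTlim (ε / 4) (by positivity)
  -- `K` absorbs the finitely many times before the averages are close to their limit.
  obtain ⟨K, hK⟩ : ∃ K : ℝ, ∀ n ≤ N₀, |T n - n * (α - β)| ≤ K := by
    refine ⟨∑ n ∈ Finset.range (N₀ + 1), |T n - n * (α - β)|, fun n hn => ?_⟩
    exact Finset.single_le_sum (f := fun n : ℕ => |T n - n * (α - β)|)
      (fun _ _ => abs_nonneg _) (Finset.mem_range.2 (by omega))
  have hK0 : 0 ≤ K := (abs_nonneg _).trans (hK 0 (Nat.zero_le _))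
  have hbound : ∀ n : ℕ, |T n - n * (α - β)| ≤ n * (ε / 4) + K := by
    intro n
    rcases le_or_gt n N₀ with hn | hn
    · have := hK n hn
      have : 0 ≤ (n : ℝ) * (ε / 4) := by positivity
      linarith
    · have hn0 : (0 : ℝ) < n := by exact_mod_cast (Nat.zero_le _).trans_lt hn
      have h1 := (hN₀ n hn.le).le
      rw [Real.dist_eq] at h1
      have h2 : T n - n * (α - β) = n * (T n / n - (α - β)) := by field_simp
      rw [h2, abs_mul, abs_of_pos hn0]
      nlinarith
  obtain ⟨N₁, hN₁⟩ := exists_nat_gt ((2 * K + q + 1) / (ε / 2))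
  refine ⟨N₁ + 1, fun n hn => ?_⟩
  have hn0 : (0 : ℝ) < n := by exact_mod_cast (by omega : 0 < n)
  have hn1 : (N₁ : ℝ) ≤ n := by exact_mod_cast (by omega : N₁ ≤ n)
  have hq := queueLen_le q ω (δ := α - β) (B := n * (ε / 4) + K) (N := n) (by linarith)
    fun m hm => (hbound m).trans (by gcongr)
  rw [div_lt_iff₀ (by positivity)] at hN₁
  rw [Real.dist_eq, sub_zero, abs_of_nonneg (by positivity), div_lt_iff₀ hn0]
  nlinarith

theorem tendsto_deliveries_div (q : ℕ) (ω : Outcome E) {α β : ℝ} (h : α ≤ β)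
    (hA : Tendsto (fun n : ℕ => (∑ k ∈ Finset.range n, (if ω.1 k then 1 else 0 : ℝ)) / n) atTop
      (𝓝 α))
    (hC : Tendsto (fun n : ℕ => (∑ k ∈ Finset.range n, (if ω.2.1 k then 1 else 0 : ℝ)) / n) atTop
      (𝓝 β)) :
    Tendsto (fun n : ℕ => (deliveries q ω n : ℝ) / n) atTop (𝓝 α) := by
  have hq : Tendsto (fun n : ℕ => (q : ℝ) / n) atTop (𝓝 0) :=
    tendsto_const_nhds.div_atTop tendsto_natCast_atTop_atTop
  have := (hq.add hA).sub (tendsto_queueLen_div q ω h hA hC)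
  rw [zero_add, sub_zero] at this
  refine this.congr fun n => ?_
  have h2 : (queueLen q ω n : ℝ) + deliveries q ω n =
      q + ∑ k ∈ Finset.range n, (if ω.1 k then 1 else 0 : ℝ) := by
    exact_mod_cast queueLen_add_deliveries q ω n
  rw [← add_div, ← sub_div, ← h2, add_sub_cancel_left]

/-- The contribution of the channel to the log-likelihood ratio. -/
theorem sum_log_slotRatio {p₀ p₁ : unitInterval} (q : ℕ) (ω : Outcome E) (n : ℕ) :
    ∑ k ∈ Finset.range n,
        Real.log (slotRatio p₀ p₁ (queueLen q ω k) (service q ω k)).toReal =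
      deliveries q ω n * Real.log (p₁ / p₀) + (transmissions q ω n - deliveries q ω n) *
        Real.log ((1 - p₁) / (1 - p₀)) := by
  rw [deliveries, transmissions]
  push_cast
  rw [← Finset.sum_sub_distrib, Finset.sum_mul, Finset.sum_mul, ← Finset.sum_add_distrib]
  refine Finset.sum_congr rfl fun k _ => ?_
  have h1 : 0 ≤ (p₁ : ℝ) / p₀ := div_nonneg p₁.2.1 p₀.2.1
  have h2 : 0 ≤ (1 - p₁ : ℝ) / (1 - p₀) :=
    div_nonneg (unitInterval.one_minus_nonneg p₁) (unitInterval.one_minus_nonneg p₀)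
  rw [service, serve, slotRatio]
  rcases Nat.eq_zero_or_pos (queueLen q ω k) with h | h
  · simp [h]
  · cases ω.2.1 k <;> simp [h, h.ne', serviceProb, ENNReal.toReal_ofReal, h1, h2]

theorem log_pathRatio_zetaUpTo {p₀ p₁ : unitInterval} (n q : ℕ) {ρ : ℕ → E → ENNReal}
    {ω : Outcome E}
    (hs : ∀ k, (slotRatio p₀ p₁ (queueLen q ω k) (service q ω k)).toReal ≠ 0)
    (hρ : ∀ j, (ρ (j + 1) (ω.2.2 (j + 1))).toReal ≠ 0) :
    Real.log (pathRatio p₀ p₁ n ρ (zetaUpTo q n ω)).toReal =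
      deliveries q ω n * Real.log (p₁ / p₀) + (transmissions q ω n - deliveries q ω n) *
        Real.log ((1 - p₁) / (1 - p₀)) +
      ∑ j ∈ Finset.range (deliveries q ω n), Real.log (ρ (j + 1) (ω.2.2 (j + 1))).toReal := by
  rw [pathRatio_zetaUpTo, ENNReal.toReal_mul, ENNReal.toReal_prod, ENNReal.toReal_prod,
    Real.log_mul (Finset.prod_ne_zero_iff.2 fun k _ => hs k)
      (Finset.prod_ne_zero_iff.2 fun j _ => hρ j),
    Real.log_prod fun k _ => hs k, Real.log_prod fun j _ => hρ j, sum_log_slotRatio]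

end Counting

/-! ### Strong laws for arrivals, channel states and measurements -/

section LargeNumbers

variable {E : Type*} [MeasurableSpace E]

/-- Strong law of large numbers for coordinates that are identically distributed from the `m`-th
one on. -/
theorem ae_tendsto_average_infinitePi (g : ℕ → Measure E) [∀ j, IsProbabilityMeasure (g j)]
    (ν : Measure E) (m : ℕ) (hg : ∀ j, m ≤ j → g j = ν) {f : E → ℝ} (hf : Measurable f)
    (hint : Integrable f ν) :
    ∀ᵐ x ∂(Measure.infinitePi g),
      Tendsto (fun n : ℕ => (∑ i ∈ Finset.range n, f (x (m + i))) / n) atTop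
        (𝓝 (∫ y, f y ∂ν)) := by
  have hmp : ∀ i, MeasurePreserving (fun x : ℕ → E => x (m + i)) (Measure.infinitePi g) ν := by
    intro i
    have := measurePreserving_eval_infinitePi g (m + i)
    rwa [hg _ (Nat.le_add_right m i)] at this
  have hlaw : ∀ i, (Measure.infinitePi g).map (fun x : ℕ → E => f (x (m + i))) = ν.map f := by
    intro i
    rw [← (hmp i).map_eq, Measure.map_map hf (hmp i).measurable]
    rfl
  have hind := iIndepFun_infinitePi (P := g) (X := fun _ => f) fun _ => hf
  have key := strong_law_ae_real (μ := Measure.infinitePi g)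
    (fun i x => f (x (m + i)))
    ((hmp 0).integrable_comp_of_integrable hint)
    (fun i j hij => hind.indepFun (by simpa using hij))
    (fun i => ⟨(hf.comp (hmp i).measurable).aemeasurable,
      (hf.comp (hmp 0).measurable).aemeasurable, by rw [hlaw, hlaw]⟩)
  have hmean : ∫ x, f (x (m + 0)) ∂(Measure.infinitePi g) = ∫ y, f y ∂ν := by
    rw [← (hmp 0).map_eq]
    exact (integral_map (hmp 0).measurable.aemeasurable hf.aestronglyMeasurable).symm
  rwa [hmean] at key

theorem ae_seqLaw_of_fst {r p : unitInterval} {g : ℕ → Measure E}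
    [∀ j, IsProbabilityMeasure (g j)] {P : (ℕ → Bool) → Prop}
    (h : ∀ᵐ a ∂(Measure.infinitePi fun _ : ℕ => bernoulliMeasure true false r), P a) :
    ∀ᵐ ω ∂(seqLaw r p g), P ω.1 :=
  Measure.quasiMeasurePreserving_fst.ae h

theorem ae_seqLaw_of_snd {r p : unitInterval} {g : ℕ → Measure E}
    [∀ j, IsProbabilityMeasure (g j)] {P : (ℕ → Bool) → Prop}
    (h : ∀ᵐ c ∂(Measure.infinitePi fun _ : ℕ => bernoulliMeasure true false p), P c) :
    ∀ᵐ ω ∂(seqLaw r p g), P ω.2.1 :=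
  Measure.quasiMeasurePreserving_snd.ae (Measure.quasiMeasurePreserving_fst.ae h)

theorem ae_seqLaw_of_thd {r p : unitInterval} {g : ℕ → Measure E}
    [∀ j, IsProbabilityMeasure (g j)] {P : (ℕ → E) → Prop}
    (h : ∀ᵐ x ∂(Measure.infinitePi g), P x) : ∀ᵐ ω ∂(seqLaw r p g), P ω.2.2 :=
  Measure.quasiMeasurePreserving_snd.ae (Measure.quasiMeasurePreserving_snd.ae h)

theorem ae_tendsto_average_bernoulli (p : unitInterval) :
    ∀ᵐ c ∂(Measure.infinitePi fun _ : ℕ => bernoulliMeasure true false p),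
      Tendsto (fun n : ℕ => (∑ k ∈ Finset.range n, (if c k then 1 else 0 : ℝ)) / n) atTop
        (𝓝 p) := by
  have := ae_tendsto_average_infinitePi (fun _ => bernoulliMeasure true false p) _ 0
    (fun _ _ => rfl) (f := fun c : Bool => (if c then 1 else 0 : ℝ)) (measurable_of_countable _)
    (integrable_bernoulliMeasure _ _ _ _)
  simpa [integral_bernoulliMeasure] using this

end LargeNumbers

/-! ### Deliveries compensated by transmissions: exponential moments -/

section Martingale

variable {E : Type*} [MeasurableSpace E]

/-- The centred channel state in a slot with queue length `q`, counted in transmissions only. -/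
noncomputable def slotNoise (p : unitInterval) (q : ℕ) (c : Bool) : ℝ :=
  if 0 < q then (if c then 1 else 0) - p else 0

/-- The compensated number of deliveries. -/
noncomputable def noise {E : Type*} (p : unitInterval) (q : ℕ) (ω : Outcome E) (n : ℕ) : ℝ :=
  ∑ k ∈ Finset.range n, slotNoise p (queueLen q ω k) (ω.2.1 k)

/-- Conservation of packets controls deliveries but not transmissions; this identity recovers the
latter once the noise is known to be `o(n)`. -/
theorem noise_eq {E : Type*} (p : unitInterval) (q : ℕ) (ω : Outcome E)
    (n : ℕ) : noise p q ω n = deliveries q ω n - p * transmissions q ω n := by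
  rw [noise, deliveries, transmissions]
  push_cast
  rw [Finset.mul_sum, ← Finset.sum_sub_distrib]
  refine Finset.sum_congr rfl fun k _ => ?_
  rw [service, serve, slotNoise]
  rcases Nat.eq_zero_or_pos (queueLen q ω k) with h | h
  · simp [h]
  · cases ω.2.1 k <;> simp [h, h.ne']

theorem measurable_noise (p : unitInterval) (q n : ℕ) :
    Measurable fun ω : Outcome E => noise p q ω n := by
  refine Finset.measurable_sum _ fun k _ => ?_
  exact (measurable_of_countable fun u : ℕ × Bool => slotNoise p u.1 u.2).comp
    ((measurable_queueLen q k).prodMk (by fun_prop))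

theorem measurable_exp_noise (p : unitInterval) (q n : ℕ) (s : ℝ) :
    Measurable fun ω : Outcome E => ENNReal.ofReal (Real.exp (s * noise p q ω n)) :=
  (Real.measurable_exp.comp ((measurable_noise p q n).const_mul s)).ennreal_ofReal

theorem noise_succ {E : Type*} (p : unitInterval) (q n : ℕ) (a c : Bool) (ω : Outcome E) :
    noise p q (seqCons a ω.1, seqCons c ω.2.1, ω.2.2) (n + 1) =
      slotNoise p q c + noise p (nextQueue q (serve q c) a) ω n := by
  rw [noise, noise, Finset.sum_range_succ', add_comm]
  congr 1
  refine Finset.sum_congr rfl fun k _ => ?_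
  have h : queueLen (nextQueue q (serve q c) a)
      (shift q (seqCons a ω.1, seqCons c ω.2.1, ω.2.2)) k =
        queueLen (nextQueue q (serve q c) a) ω k :=
    queueLen_congr (ω := shift q (seqCons a ω.1, seqCons c ω.2.1, ω.2.2)) (ω' := ω) rfl rfl k
  rw [← queueLen_shift, ← h]
  rfl

/-- For `|x| ≤ 1` one has `exp x ≤ 1 + x + x²`. The linear term averages to zero, the increment is
at most `1` in absolute value, and `1 + s² ≤ exp (s²)`. -/
theorem lintegral_exp_slotNoise_le (p : unitInterval) (q : ℕ) {s : ℝ} (hs : |s| ≤ 1) :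
    ∫⁻ c, ENNReal.ofReal (Real.exp (s * slotNoise p q c)) ∂(bernoulliMeasure true false p) ≤
      ENNReal.ofReal (Real.exp (s ^ 2)) := by
  have hp0 := p.2.1
  have hp1 := unitInterval.one_minus_nonneg p
  rw [lintegral_bernoulliMeasure, ← ENNReal.ofReal_mul hp0, ← ENNReal.ofReal_mul hp1,
    ← ENNReal.ofReal_add (by positivity) (mul_nonneg hp1 (Real.exp_pos _).le)]
  refine ENNReal.ofReal_le_ofReal ?_
  rcases Nat.eq_zero_or_pos q with rfl | hq
  · simp [slotNoise, sq_nonneg]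
  · simp only [slotNoise, hq, if_true, Bool.false_eq_true, if_false]
    have hexp : ∀ d : ℝ, |d| ≤ 1 → Real.exp (s * d) ≤ 1 + s * d + s ^ 2 := by
      intro d hd
      have h1 : |s * d| ≤ 1 := by
        rw [abs_mul]; exact mul_le_one₀ hs (abs_nonneg _) hd
      have h2 := (abs_le.1 (Real.abs_exp_sub_one_sub_id_le h1)).2
      have h3 : d ^ 2 ≤ 1 := (sq_le_one_iff_abs_le_one d).2 hd
      nlinarith [sq_nonneg s]
    have h1 := hexp (1 - p) (by rw [abs_of_nonneg hp1]; linarith)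
    have h2 := hexp (0 - p) (by rw [zero_sub, abs_neg, abs_of_nonneg hp0]; exact p.2.2)
    have h3 := Real.add_one_le_exp (s ^ 2)
    nlinarith [mul_le_mul_of_nonneg_left h1 hp0, mul_le_mul_of_nonneg_left h2 hp1]

/-- The one-slot bound is uniform in the queue length, so conditioning on the first slot yields one
factor per slot although the increments depend on the past. -/
theorem lintegral_exp_noise_le (r p : unitInterval) (g : ℕ → Measure E)
    [∀ j, IsProbabilityMeasure (g j)] {s : ℝ} (hs : |s| ≤ 1) (n q : ℕ) :
    ∫⁻ ω, ENNReal.ofReal (Real.exp (s * noise p q ω n)) ∂(seqLaw r p g) ≤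
      ENNReal.ofReal (Real.exp (s ^ 2)) ^ n := by
  induction n generalizing q with
  | zero => simp [noise]
  | succ n ih =>
    rw [lintegral_seqLaw_slot r p g (measurable_exp_noise p q (n + 1) s)]
    have hb : ∀ a : Bool, ∫⁻ c, ∫⁻ ω, ENNReal.ofReal (Real.exp (s *
          noise p q (seqCons a ω.1, seqCons c ω.2.1, ω.2.2) (n + 1))) ∂(seqLaw r p g)
        ∂(bernoulliMeasure true false p) ≤ ENNReal.ofReal (Real.exp (s ^ 2)) ^ (n + 1) := by
      intro a
      simp_rw [noise_succ, mul_add, Real.exp_add, ENNReal.ofReal_mul (Real.exp_pos _).le]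
      simp_rw [lintegral_const_mul _ (measurable_exp_noise p _ n s)]
      refine (lintegral_mono fun c => mul_le_mul_right (ih _) _).trans ?_
      rw [lintegral_mul_const _ (measurable_of_countable _), pow_succ, mul_comm]
      exact mul_le_mul_right (lintegral_exp_slotNoise_le p q hs) _
    refine (lintegral_mono hb).trans ?_
    rw [lintegral_const, measure_univ, mul_one]

/-- A Chernoff bound: of the exponent `2 s²`, one `s²` pays for the exponential moment and the other
leaves the geometric bound `exp (-s² n)`. The expected sum is finite, so almost surely the terms
tend to `0` and are eventually below `1`. -/
theorem ae_eventually_noise_lt (r p : unitInterval) (g : ℕ → Measure E)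
    [∀ j, IsProbabilityMeasure (g j)] (q : ℕ) {s : ℝ} (hs : |s| ≤ 1) (hs0 : s ≠ 0) :
    ∀ᵐ ω ∂(seqLaw r p g), ∀ᶠ n : ℕ in atTop, s * noise p q ω n < 2 * s ^ 2 * n := by
  have hmeas : ∀ n : ℕ, Measurable fun ω : Outcome E =>
      ENNReal.ofReal (Real.exp (s * noise p q ω n - 2 * s ^ 2 * n)) := fun n =>
    (Real.measurable_exp.comp (((measurable_noise p q n).const_mul s).sub_const _)).ennreal_ofReal
  have hle : ∀ n : ℕ, ∫⁻ ω, ENNReal.ofReal (Real.exp (s * noise p q ω n - 2 * s ^ 2 * n))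
      ∂(seqLaw r p g) ≤ ENNReal.ofReal (Real.exp (-s ^ 2)) ^ n := by
    intro n
    simp_rw [sub_eq_add_neg, Real.exp_add, ENNReal.ofReal_mul (Real.exp_pos _).le]
    rw [lintegral_mul_const _ (measurable_exp_noise p q n s)]
    refine (mul_le_mul_left (lintegral_exp_noise_le r p g hs n q) _).trans_eq ?_
    rw [← ENNReal.ofReal_pow (Real.exp_pos _).le, ← ENNReal.ofReal_pow (Real.exp_pos _).le,
      ← ENNReal.ofReal_mul (by positivity), ← Real.exp_nat_mul, ← Real.exp_nat_mul, ← Real.exp_add]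
    congr 2
    ring
  have hlt : ENNReal.ofReal (Real.exp (-s ^ 2)) < 1 := by
    rw [ENNReal.ofReal_lt_one, Real.exp_lt_one_iff]
    have : 0 < s ^ 2 := by positivity
    linarith
  have hfin : ∫⁻ ω, ∑' n : ℕ, ENNReal.ofReal (Real.exp (s * noise p q ω n - 2 * s ^ 2 * n))
      ∂(seqLaw r p g) ≠ ⊤ := by
    rw [lintegral_tsum fun n => (hmeas n).aemeasurable]
    refine ne_top_of_le_ne_top ?_ (ENNReal.tsum_le_tsum hle)
    rw [ENNReal.tsum_geometric]
    exact ENNReal.inv_ne_top.2 (tsub_pos_of_lt hlt).ne'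
  filter_upwards [ae_lt_top (Measurable.tsum hmeas) hfin] with ω hω
  filter_upwards [(tendsto_order.1 (ENNReal.tendsto_atTop_zero_of_tsum_ne_top hω.ne)).2 1
    zero_lt_one] with n hn
  rw [ENNReal.ofReal_lt_one, Real.exp_lt_one_iff] at hn
  linarith

/-- Dividing the bounds for `s = ±1/(m+1)` by `|s|` gives `|noise| < 2 n / (m+1)` eventually, for
all `m` at once. -/
theorem ae_tendsto_noise_div (r p : unitInterval) (g : ℕ → Measure E)
    [∀ j, IsProbabilityMeasure (g j)] (q : ℕ) :
    ∀ᵐ ω ∂(seqLaw r p g), Tendsto (fun n : ℕ => noise p q ω n / n) atTop (𝓝 0) := by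
  have hm : ∀ m : ℕ, |1 / ((m : ℝ) + 1)| ≤ 1 := fun m => by
    rw [abs_of_pos Nat.one_div_pos_of_nat]
    exact (div_le_one (by positivity)).2 (by linarith [m.cast_nonneg (α := ℝ)])
  have h1 := ae_all_iff.2 fun m : ℕ =>
    ae_eventually_noise_lt r p g q (hm m) Nat.one_div_pos_of_nat.ne'
  have h2 := ae_all_iff.2 fun m : ℕ =>
    ae_eventually_noise_lt r p g q (s := -(1 / ((m : ℝ) + 1))) (by rw [abs_neg]; exact hm m)
      (neg_ne_zero.2 Nat.one_div_pos_of_nat.ne')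
  filter_upwards [h1, h2] with ω h1 h2
  -- The form with `n > N` guarantees `n > 0`.
  rw [Metric.tendsto_atTop']
  intro ε hε
  obtain ⟨m, hm⟩ := exists_nat_one_div_lt (half_pos hε)
  obtain ⟨N, hN⟩ := eventually_atTop.1 ((h1 m).and (h2 m))
  refine ⟨N, fun n hn => ?_⟩
  obtain ⟨ha, hb⟩ := hN n hn.le
  have hn0 : (0 : ℝ) < n := by exact_mod_cast (Nat.zero_le _).trans_lt hn
  have hs : (0 : ℝ) < 1 / ((m : ℝ) + 1) := Nat.one_div_pos_of_nat
  generalize 1 / ((m : ℝ) + 1) = s at *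
  rw [Real.dist_eq, sub_zero, abs_div, abs_of_pos hn0, div_lt_iff₀ hn0]
  have hlt : |noise p q ω n| < 2 * s * n := by
    rw [abs_lt]
    constructor
    · by_contra! h; nlinarith
    · by_contra! h; nlinarith
  nlinarith

end Martingale

/-! ### Almost sure limit of the normalized log-likelihood ratio -/

section LikelihoodRatio

variable {E : Type*} [MeasurableSpace E]

/-- Likelihood ratio of the measurement in packet number `j` when the first `q` packets are not
affected by the change. -/
noncomputable def packetRatio (q : ℕ) (f₀ f₁ : Measure E) (j : ℕ) : E → ENNReal :=
  if j ≤ q then fun _ => 1 else f₁.rnDeriv f₀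

theorem measurable_packetRatio (q : ℕ) (f₀ f₁ : Measure E) (j : ℕ) :
    Measurable (packetRatio q f₀ f₁ j) := by
  unfold packetRatio
  split_ifs
  · exact measurable_const
  · exact Measure.measurable_rnDeriv _ _

/-- The Radon–Nikodym derivative equals the explicit density almost everywhere for the pre-change
law of the observations, hence also for the post-change law, which is absolutely continuous with
respect to it. -/
theorem ae_logLikelihood_eq (f₀ f₁ : Measure E) [IsProbabilityMeasure f₀]
    [IsProbabilityMeasure f₁] {r p₀ p₁ : unitInterval} (h0 : 0 < (p₀ : ℝ))
    (hp : (p₀ : ℝ) < 1 ∨ (p₁ : ℝ) = 1) (hac : f₁ ≪ f₀) (q n : ℕ) :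
    ∀ᵐ ω ∂(lawPost q r p₁ f₀ f₁), logLikelihood q r p₀ p₁ f₀ f₁ n ω =
      Real.log (pathRatio p₀ p₁ n (packetRatio q f₀ f₁) (zetaUpTo q n ω)).toReal := by
  -- The trivial conditional is the form to which `law q r p₀ f₀ f₀` unfolds.
  have he : ∀ j : ℕ, IsProbabilityMeasure (if j ≤ q then f₀ else f₀) := by
    intro j; split_ifs <;> infer_instance
  have hg : ∀ j : ℕ, IsProbabilityMeasure (if j ≤ q then f₀ else f₁) := by
    intro j; split_ifs <;> infer_instance
  have hρ := measurable_packetRatio q f₀ f₁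
  have hmap := map_zetaUpTo_seqLaw (r := r) h0 hp n (fun j => if j ≤ q then f₀ else f₀)
    (fun j => if j ≤ q then f₀ else f₁) hρ (fun j => by
      unfold packetRatio
      split_ifs
      · exact withDensity_one.symm
      · exact (Measure.withDensity_rnDeriv_eq _ _ hac).symm) q
  change (lawPost q r p₁ f₀ f₁).map _ = ((lawPre q r p₀ f₀).map _).withDensity _ at hmap
  have hprob : IsProbabilityMeasure (lawPre q r p₀ f₀) := isProbabilityMeasure_law q r p₀ f₀ f₀
  have hfin : IsFiniteMeasure ((lawPre q r p₀ f₀).map (zetaUpTo q n)) := inferInstance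
  have hrn := Measure.rnDeriv_withDensity ((lawPre q r p₀ f₀).map (zetaUpTo q n))
    (measurable_pathRatio p₀ p₁ n hρ)
  rw [← hmap] at hrn
  have hac' : (lawPost q r p₁ f₀ f₁).map (zetaUpTo q n) ≪
      (lawPre q r p₀ f₀).map (zetaUpTo q n) := by
    rw [hmap]; exact withDensity_absolutelyContinuous _ _
  filter_upwards [ae_of_ae_map (measurable_zetaUpTo q n).aemeasurable (hac'.ae_le hrn)] with ω hω
  rw [logLikelihood, llr, hω]

/-- Needed to take the logarithm of the product. A factor could vanish only at a failure with `p₁ =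
1`, which has probability zero; if `p₁ < 1`, then `hp` gives `p₀ < 1`. -/
theorem ae_slotRatio_ne_zero {r p₀ p₁ : unitInterval} (h0 : 0 < (p₀ : ℝ)) (h1 : 0 < (p₁ : ℝ))
    (hp : (p₀ : ℝ) < 1 ∨ (p₁ : ℝ) = 1) (g : ℕ → Measure E) [∀ j, IsProbabilityMeasure (g j)]
    (q : ℕ) :
    ∀ᵐ ω ∂(seqLaw r p₁ g),
      ∀ k, (slotRatio p₀ p₁ (queueLen q ω k) (service q ω k)).toReal ≠ 0 := by
  have hc : ∀ᵐ c ∂(Measure.infinitePi fun _ : ℕ => bernoulliMeasure true false p₁),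
      ∀ k, c k = false → (p₁ : ℝ) < 1 := by
    refine ae_all_iff.2 fun k => ?_
    rcases p₁.2.2.lt_or_eq with h | h
    · exact ae_of_all _ fun _ _ => h
    · obtain rfl : p₁ = 1 := Subtype.ext h
      have h3 : ∀ᵐ c ∂(bernoulliMeasure true false (1 : unitInterval)), c = true := by
        rw [bernoulliMeasure_one, ae_dirac_iff (by measurability)]
      have h2 := (measurePreserving_eval_infinitePi
        (fun _ : ℕ => bernoulliMeasure true false (1 : unitInterval)) k).quasiMeasurePreserving.ae h3
      filter_upwards [h2] with c hc hf
      simp [Function.eval, hf] at hc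
  filter_upwards [ae_seqLaw_of_snd hc] with ω hω k
  rw [service, serve, slotRatio]
  rcases Nat.eq_zero_or_pos (queueLen q ω k) with h | h
  · simp [h]
  · rcases hck : ω.2.1 k with _ | _
    · have h2 := hω k hck
      have h3 : (p₀ : ℝ) < 1 := hp.resolve_right h2.ne
      have h4 : (0 : ℝ) < (1 - p₁) / (1 - p₀) := div_pos (by linarith) (by linarith)
      simp only [h, h.ne', if_true, if_false, Bool.false_eq_true, serviceProb]
      rw [ENNReal.toReal_ofReal h4.le]
      exact h4.ne'
    · have h4 : (0 : ℝ) < p₁ / p₀ := div_pos h1 h0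
      simp only [h, h.ne', if_true, if_false, serviceProb]
      rw [ENNReal.toReal_ofReal h4.le]
      exact h4.ne'

theorem ae_packetRatio_ne_zero (f₀ f₁ : Measure E) [IsProbabilityMeasure f₀]
    [IsProbabilityMeasure f₁] (hac : f₁ ≪ f₀) (q : ℕ) (g : ℕ → Measure E)
    [∀ j, IsProbabilityMeasure (g j)] (hg : ∀ j, q < j → g j = f₁) :
    ∀ᵐ x ∂(Measure.infinitePi g),
      ∀ j, (packetRatio q f₀ f₁ (j + 1) (x (j + 1))).toReal ≠ 0 := by
  refine ae_all_iff.2 fun j => ?_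
  unfold packetRatio
  split_ifs with h
  · simp
  · have hmp := measurePreserving_eval_infinitePi g (j + 1)
    rw [hg _ (by omega)] at hmp
    filter_upwards [hmp.quasiMeasurePreserving.ae (Measure.rnDeriv_pos hac),
      hmp.quasiMeasurePreserving.ae (hac.ae_le (Measure.rnDeriv_lt_top f₁ f₀))] with x h1 h2
    exact (ENNReal.toReal_pos h1.ne' h2.ne).ne'

theorem ae_tendsto_average_log_packetRatio (f₀ f₁ : Measure E) [IsProbabilityMeasure f₀]
    [IsProbabilityMeasure f₁] (hf : klDiv f₁ f₀ ≠ ⊤) (q : ℕ) (g : ℕ → Measure E)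
    [∀ j, IsProbabilityMeasure (g j)] (hg : ∀ j, q < j → g j = f₁) :
    ∀ᵐ x ∂(Measure.infinitePi g), Tendsto (fun n : ℕ => (∑ j ∈ Finset.range n,
        Real.log (packetRatio q f₀ f₁ (j + 1) (x (j + 1))).toReal) / n) atTop
      (𝓝 (klDiv f₁ f₀).toReal) := by
  obtain ⟨hac, hint⟩ := klDiv_ne_top_iff.1 hf
  rw [toReal_klDiv_of_measure_eq hac (by simp)]
  filter_upwards [ae_tendsto_average_infinitePi g f₁ (q + 1) (fun j hj => hg j hj)
    (measurable_llr f₁ f₀) hint] with x hx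
  -- Shifting by `q` removes the initial packets, whose log-ratio is `log 1 = 0`; the denominator `n
  -- + q` is corrected by `n / (n + q) → 1`.
  rw [← tendsto_add_atTop_iff_nat q]
  have hone : Tendsto (fun n : ℕ => (n : ℝ) / (n + q : ℝ)) atTop (𝓝 1) :=
    tendsto_natCast_div_add_atTop (q : ℝ)
  have := hx.mul hone
  rw [mul_one] at this
  refine this.congr fun n => ?_
  have hsum : ∑ j ∈ Finset.range (n + q),
      Real.log (packetRatio q f₀ f₁ (j + 1) (x (j + 1))).toReal =
        ∑ i ∈ Finset.range n, llr f₁ f₀ (x (q + 1 + i)) := by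
    rw [add_comm n q, Finset.sum_range_add, Finset.sum_eq_zero, zero_add]
    · refine Finset.sum_congr rfl fun i _ => ?_
      rw [packetRatio, if_neg (by omega), llr, show q + i + 1 = q + 1 + i by omega]
    · intro j hj
      have := Finset.mem_range.1 hj
      rw [packetRatio, if_pos (by omega)]
      simp
  rw [hsum]
  push_cast
  rcases Nat.eq_zero_or_pos n with rfl | hn
  · simp
  · have : (n : ℝ) ≠ 0 := by exact_mod_cast hn.ne'
    rw [div_mul_div_cancel₀ this]

theorem ae_tendsto_logLikelihood (f₀ f₁ : Measure E) [IsProbabilityMeasure f₀]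
    [IsProbabilityMeasure f₁] {r p₀ p₁ : unitInterval} (hr : 0 < (r : ℝ)) (hr₀ : (r : ℝ) < p₀)
    (hr₁ : (r : ℝ) < p₁) (hp : (p₀ : ℝ) < 1 ∨ (p₁ : ℝ) = 1) (hf : klDiv f₁ f₀ ≠ ⊤) (q : ℕ) :
    ∀ᵐ ω ∂(lawPost q r p₁ f₀ f₁),
      Tendsto (fun n : ℕ => (1 / (n : ℝ)) * logLikelihood q r p₀ p₁ f₀ f₁ n ω) atTop
        (𝓝 (r * (bernoulliKL p₁ p₀ / p₁ + (klDiv f₁ f₀).toReal))) := by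
  have h0 : 0 < (p₀ : ℝ) := hr.trans hr₀
  have h1 : 0 < (p₁ : ℝ) := hr.trans hr₁
  have hac := (klDiv_ne_top_iff.1 hf).1
  have hg : ∀ j : ℕ, IsProbabilityMeasure (if j ≤ q then f₀ else f₁) := by
    intro j; split_ifs <;> infer_instance
  have hg' : ∀ j : ℕ, q < j → (if j ≤ q then f₀ else f₁) = f₁ := fun j hj =>
    if_neg (by omega)
  have hL := ae_all_iff.2 fun n => ae_logLikelihood_eq (r := r) f₀ f₁ h0 hp hac q n
  change ∀ᵐ ω ∂(seqLaw r p₁ fun j => if j ≤ q then f₀ else f₁), _ at hL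
  change ∀ᵐ ω ∂(seqLaw r p₁ fun j => if j ≤ q then f₀ else f₁), _
  filter_upwards [hL, ae_slotRatio_ne_zero h0 h1 hp _ q,
    ae_seqLaw_of_thd (ae_packetRatio_ne_zero f₀ f₁ hac q _ hg'),
    ae_seqLaw_of_thd (ae_tendsto_average_log_packetRatio f₀ f₁ hf q _ hg'),
    ae_seqLaw_of_fst (ae_tendsto_average_bernoulli r),
    ae_seqLaw_of_snd (ae_tendsto_average_bernoulli p₁),
    ae_tendsto_noise_div r p₁ _ q] with ω hL hs hρ hX hA hC hM
  have hD := tendsto_deliveries_div q ω hr₁.le hA hC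
  -- Transmissions equal deliveries minus noise, divided by `p₁`.
  have hN : Tendsto (fun n : ℕ => (transmissions q ω n : ℝ) / n) atTop (𝓝 (r / p₁)) := by
    have := (hD.sub hM).div_const (p₁ : ℝ)
    rw [sub_zero] at this
    refine this.congr fun n => ?_
    rw [noise_eq, ← sub_div, sub_sub_cancel, mul_div_assoc, mul_div_cancel_left₀ _ h1.ne']
  -- Since `r > 0`, deliveries tend to infinity, so the strong law for the measurements can be
  -- evaluated at this random index.
  have hDtop : Tendsto (deliveries q ω) atTop atTop := by
    rw [← tendsto_natCast_atTop_iff (R := ℝ)]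
    refine (hD.pos_mul_atTop hr tendsto_natCast_atTop_atTop).congr' ?_
    filter_upwards [eventually_ne_atTop 0] with n hn
    exact div_mul_cancel₀ _ (by exact_mod_cast hn)
  have hXD : Tendsto (fun n : ℕ => (∑ j ∈ Finset.range (deliveries q ω n),
      Real.log (packetRatio q f₀ f₁ (j + 1) (ω.2.2 (j + 1))).toReal) / n) atTop
      (𝓝 ((klDiv f₁ f₀).toReal * r)) := by
    refine ((hX.comp hDtop).mul hD).congr fun n => ?_
    rcases Nat.eq_zero_or_pos (deliveries q ω n) with h | h
    · simp [h]
    · exact div_mul_div_cancel₀ (by exact_mod_cast h.ne')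
  have hlim := ((hD.mul_const (Real.log (p₁ / p₀))).add
    ((hN.sub hD).mul_const (Real.log ((1 - p₁) / (1 - p₀))))).add hXD
  have hval : (r : ℝ) * (bernoulliKL p₁ p₀ / p₁ + (klDiv f₁ f₀).toReal) =
      r * Real.log (p₁ / p₀) + (r / p₁ - r) * Real.log ((1 - p₁) / (1 - p₀)) +
        (klDiv f₁ f₀).toReal * r := by
    rw [bernoulliKL]; field_simp
  rw [hval]
  refine hlim.congr fun n => ?_
  rw [hL n, log_pathRatio_zetaUpTo n q hs hρ]
  ring

end LikelihoodRatio

/-! ### Reduction of the observation process to the queue -/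

section Emission

variable {E : Type*} [MeasurableSpace E]

/-- Observation in a slot with given queue length, channel state and measurement. -/
def emit {E : Type*} (t : ℕ × Bool × E) : Obs E :=
  (t.1, serve t.1 t.2.1, receive (serve t.1 t.2.1) t.2.2)

theorem measurable_emit : Measurable (emit : ℕ × Bool × E → Obs E) := by
  have hy : Measurable fun t : ℕ × Bool × E => serve t.1 t.2.1 :=
    (measurable_of_countable fun u : ℕ × Bool => serve u.1 u.2).comp
      (f := fun t : ℕ × Bool × E => (t.1, t.2.1)) (by fun_prop)
  exact measurable_fst.prodMk (hy.prodMk (measurable_receive.comp (hy.prodMk (by fun_prop))))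

/-- Law of the observation in a slot in which the queue length has law `ν`. -/
noncomputable def emitLaw (p : unitInterval) (g : Measure E) (ν : Measure ℕ) : Measure (Obs E) :=
  (ν.prod ((bernoulliMeasure true false p).prod g)).map emit

instance (p : unitInterval) (g : Measure E) [IsProbabilityMeasure g] (ν : Measure ℕ)
    [IsProbabilityMeasure ν] : IsProbabilityMeasure (emitLaw p g ν) :=
  Measure.isProbabilityMeasure_map measurable_emit.aemeasurable

/-- Law of the queue length in the next slot when the observation has law `m`. -/
noncomputable def nextQueueLaw (r : unitInterval) (m : Measure (Obs E)) : Measure ℕ :=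
  (m.prod (bernoulliMeasure true false r)).map fun t => nextQueue t.1.1 t.1.2.1 t.2

theorem measurable_nextQueue :
    Measurable fun t : Obs E × Bool => nextQueue t.1.1 t.1.2.1 t.2 :=
  (measurable_of_countable fun u : ℕ × Service × Bool => nextQueue u.1 u.2.1 u.2.2).comp
    (f := fun t : Obs E × Bool => (t.1.1, t.1.2.1, t.2)) (by fun_prop)

instance (r : unitInterval) (m : Measure (Obs E)) [IsProbabilityMeasure m] :
    IsProbabilityMeasure (nextQueueLaw r m) :=
  Measure.isProbabilityMeasure_map measurable_nextQueue.aemeasurable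

/-- A step first updates the queue and then draws a fresh channel state and measurement, so the old
observation matters only through the law of the next queue length. -/
theorem bind_transition (r p : unitInterval) (g : Measure E) [IsProbabilityMeasure g]
    (m : Measure (Obs E)) [IsProbabilityMeasure m] :
    m.bind (transition r p g) = emitLaw p g (nextQueueLaw r m) := by
  have h1 : m.bind (transition r p g) = (m.prod ((bernoulliMeasure true false r).prod
      ((bernoulliMeasure true false p).prod g))).map step := by
    rw [transition, ← Measure.map_comp _ _ measurable_step, ← Measure.compProd_eq_comp_prod,
      Measure.compProd_const]
  have h2 : Measurable fun t : (Obs E × Bool) × Bool × E =>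
      (nextQueue t.1.1.1 t.1.1.2.1 t.1.2, t.2) :=
    (measurable_nextQueue.comp measurable_fst).prodMk measurable_snd
  have h3 : (nextQueueLaw r m).prod ((bernoulliMeasure true false p).prod g) =
      ((m.prod (bernoulliMeasure true false r)).prod ((bernoulliMeasure true false p).prod g)).map
        (Prod.map (fun t => nextQueue t.1.1 t.1.2.1 t.2) id) := by
    rw [← Measure.map_prod_map _ _ measurable_nextQueue measurable_id, Measure.map_id]
    rfl
  rw [h1, emitLaw, h3, Measure.map_map measurable_emit
    (measurable_nextQueue.prodMap measurable_id), ← Measure.prodAssoc_prod,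
    Measure.map_map measurable_step (MeasurableEquiv.measurable _)]
  rfl

/-- Transition probabilities of the queue. -/
noncomputable def queueStep (r p : unitInterval) (i j : ℕ) : ENNReal :=
  ∫⁻ c, ∫⁻ a, (if nextQueue i (serve i c) a = j then 1 else 0)
    ∂(bernoulliMeasure true false r) ∂(bernoulliMeasure true false p)

theorem nextQueueLaw_emitLaw (r p : unitInterval) (g : Measure E) [IsProbabilityMeasure g]
    (ν : Measure ℕ) [IsProbabilityMeasure ν] (j : ℕ) :
    nextQueueLaw r (emitLaw p g ν) {j} = ∑' i, ν {i} * queueStep r p i j := by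
  have hf : Measurable fun t : Obs E × Bool =>
      (if nextQueue t.1.1 t.1.2.1 t.2 = j then 1 else 0 : ENNReal) :=
    (measurable_of_countable fun n : ℕ => (if n = j then 1 else 0 : ENNReal)).comp
      measurable_nextQueue
  have h1 : nextQueueLaw r (emitLaw p g ν) {j} =
      ∫⁻ t, (if nextQueue t.1.1 t.1.2.1 t.2 = j then 1 else 0)
        ∂((emitLaw p g ν).prod (bernoulliMeasure true false r)) := by
    rw [nextQueueLaw, Measure.map_apply measurable_nextQueue (measurableSet_singleton j),
      ← lintegral_indicator_one (measurable_nextQueue (measurableSet_singleton j))]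
    refine lintegral_congr fun t => ?_
    by_cases h : nextQueue t.1.1 t.1.2.1 t.2 = j
    · rw [if_pos h, Set.indicator_of_mem (by exact h), Pi.one_apply]
    · rw [if_neg h, Set.indicator_of_notMem (by exact h)]
  have h2 : Measurable fun s : Obs E => ∫⁻ a, (if nextQueue s.1 s.2.1 a = j then 1 else 0)
      ∂(bernoulliMeasure true false r) := hf.lintegral_prod_right'
  have h3 := h2.comp measurable_emit
  rw [h1, lintegral_prod _ hf.aemeasurable, emitLaw, lintegral_map h2 measurable_emit]
  refine (lintegral_prod _ h3.aemeasurable).trans ?_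
  rw [lintegral_countable']
  refine tsum_congr fun i => ?_
  rw [mul_comm, queueStep]
  congr 1
  refine (lintegral_prod _ (h3.comp measurable_prodMk_left).aemeasurable).trans ?_
  refine lintegral_congr fun c => ?_
  change ∫⁻ _, (∫⁻ a, (if nextQueue i (serve i c) a = j then 1 else 0)
    ∂(bernoulliMeasure true false r)) ∂g = _
  rw [lintegral_const, measure_univ, mul_one]

end Emission

/-! ### Balance equations of the queue and their geometric solution -/

section Balance

theorem queueStep_eq (r p : unitInterval) (i j : ℕ) :
    queueStep r p i j =
      ENNReal.ofReal (p * (r * (if nextQueue i (serve i true) true = j then 1 else 0) +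
          (1 - r) * (if nextQueue i (serve i true) false = j then 1 else 0)) +
        (1 - p) * (r * (if nextQueue i (serve i false) true = j then 1 else 0) +
          (1 - r) * (if nextQueue i (serve i false) false = j then 1 else 0))) := by
  have hp0 := p.2.1
  have hp1 := unitInterval.one_minus_nonneg p
  have hr0 := r.2.1
  have hr1 := unitInterval.one_minus_nonneg r
  have h : ∀ y, (0 : ℝ) ≤ r * (if nextQueue i y true = j then 1 else 0) +
      (1 - r) * (if nextQueue i y false = j then 1 else 0) := fun y => by
    split_ifs <;> simp [hr0, hr1]
  have h' : ∀ y, ENNReal.ofReal (r * (if nextQueue i y true = j then 1 else 0) +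
      (1 - r) * (if nextQueue i y false = j then 1 else 0)) =
        ENNReal.ofReal r * (if nextQueue i y true = j then 1 else 0) +
          ENNReal.ofReal (1 - r) * (if nextQueue i y false = j then 1 else 0) := fun y => by
    rw [ENNReal.ofReal_add, ENNReal.ofReal_mul hr0, ENNReal.ofReal_mul hr1] <;>
    split_ifs <;> simp [hr0, hr1]
  rw [queueStep, lintegral_bernoulliMeasure, lintegral_bernoulliMeasure, lintegral_bernoulliMeasure,
    ENNReal.ofReal_add (mul_nonneg hp0 (h _)) (mul_nonneg hp1 (h _)), ENNReal.ofReal_mul hp0,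
    ENNReal.ofReal_mul hp1, h', h']

/-- A law on queue lengths that is preserved by the transition probabilities of the queue. -/
def IsStationaryQueue (r p : unitInterval) (ν : Measure ℕ) : Prop :=
  ∀ j, ν {j} = ∑' i, ν {i} * queueStep r p i j

theorem queueStep_zero_right (r p : unitInterval) (i : ℕ) (hi : 2 ≤ i) :
    queueStep r p i 0 = 0 := by
  have h0 : i ≠ 0 := by omega
  have h1 : i - 1 ≠ 0 := by omega
  simp [queueStep_eq, nextQueue, serve, h0, h1]

theorem queueStep_succ_right (r p : unitInterval) (i j : ℕ) (h : i < j ∨ j + 2 < i) :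
    queueStep r p i (j + 1) = 0 := by
  rcases Nat.eq_zero_or_pos i with rfl | h0
  · have hj : j ≠ 0 := by omega
    simp [queueStep_eq, nextQueue, serve, hj]
  · have h1 : i - 1 + 1 ≠ j + 1 := by omega
    have h2 : i - 1 ≠ j + 1 := by omega
    have h3 : i ≠ j := by omega
    have h4 : i ≠ j + 1 := by omega
    simp only [queueStep_eq, nextQueue, serve, h0.ne', if_true, if_false, reduceCtorEq,
      Bool.false_eq_true, h1, h2, h4, tsub_zero, add_zero, add_left_inj, h3]
    simp

theorem sum_queueStep_zero (r p : unitInterval) (ν : Measure ℕ) [IsProbabilityMeasure ν] :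
    (∑' i, ν {i} * queueStep r p i 0).toReal =
      ν.real {0} * (1 - r) + ν.real {1} * (p * (1 - r)) := by
  have hr1 := unitInterval.one_minus_nonneg r
  rw [tsum_eq_sum (s := {0, 1}) fun i hi => by
    simp only [Finset.mem_insert, Finset.mem_singleton, not_or] at hi
    rw [queueStep_zero_right r p i (by omega), mul_zero]]
  rw [Finset.sum_pair (by norm_num), queueStep_eq, queueStep_eq, ENNReal.toReal_add (by finiteness)
    (by finiteness), ENNReal.toReal_mul, ENNReal.toReal_mul]
  simp only [nextQueue, serve, Measure.real]
  simp
  rw [ENNReal.toReal_ofReal, ENNReal.toReal_ofReal]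
  · ring
  · exact mul_nonneg p.2.1 hr1
  · nlinarith

/-- The queue changes by at most one per slot, so only three states feed `j + 1`. An empty queue
cannot deliver, hence its upward rate is `r` instead of `r * (1 - p)`. -/
theorem sum_queueStep_succ (r p : unitInterval) (ν : Measure ℕ) [IsProbabilityMeasure ν] (j : ℕ) :
    (∑' i, ν {i} * queueStep r p i (j + 1)).toReal =
      ν.real {j} * (if j = 0 then (r : ℝ) else r * (1 - p)) +
        ν.real {j + 1} * (r * p + (1 - r) * (1 - p)) + ν.real {j + 2} * (p * (1 - r)) := by
  have hp0 := p.2.1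
  have hr0 := r.2.1
  have hp1 := unitInterval.one_minus_nonneg p
  have hr1 := unitInterval.one_minus_nonneg r
  have e0 : queueStep r p j (j + 1) =
      ENNReal.ofReal (if j = 0 then (r : ℝ) else r * (1 - p)) := by
    rw [queueStep_eq]
    congr 1
    rcases Nat.eq_zero_or_pos j with rfl | h
    · simp [nextQueue, serve]; ring
    · have h1 : j - 1 ≠ j := by omega
      have h2 : j - 1 ≠ j + 1 := by omega
      simp [nextQueue, serve, h.ne', h1, h2]; ring
  have e1 : queueStep r p (j + 1) (j + 1) = ENNReal.ofReal (r * p + (1 - r) * (1 - p)) := by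
    rw [queueStep_eq]
    congr 1
    simp [nextQueue, serve]; ring
  have e2 : queueStep r p (j + 2) (j + 1) = ENNReal.ofReal (p * (1 - r)) := by
    rw [queueStep_eq]
    congr 1
    simp [nextQueue, serve]
  rw [tsum_eq_sum (s := {j, j + 1, j + 2}) fun i hi => by
    simp only [Finset.mem_insert, Finset.mem_singleton, not_or] at hi
    rw [queueStep_succ_right r p i j (by omega), mul_zero]]
  rw [Finset.sum_insert (by simp), Finset.sum_pair (by simp), e0, e1, e2,
    ENNReal.toReal_add (by finiteness) (by finiteness),
    ENNReal.toReal_add (by finiteness) (by finiteness), ENNReal.toReal_mul, ENNReal.toReal_mul,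
    ENNReal.toReal_mul, ENNReal.toReal_ofReal, ENNReal.toReal_ofReal, ENNReal.toReal_ofReal,
    ← add_assoc]
  · rfl
  · exact mul_nonneg hp0 hr1
  · positivity
  · split_ifs <;> positivity

/-- Global balance of the queue is equivalent to the balance of flows between neighbouring queue
lengths. -/
theorem isStationaryQueue_iff (r p : unitInterval) (ν : Measure ℕ) [IsProbabilityMeasure ν] :
    IsStationaryQueue r p ν ↔ ∀ j, ν.real {j} * (if j = 0 then (r : ℝ) else r * (1 - p)) =
      ν.real {j + 1} * (p * (1 - r)) := by
  have hle : ∀ i j, queueStep r p i j ≤ 1 := fun i j => by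
    refine (lintegral_mono fun c => (lintegral_mono (g := fun _ => 1) fun a => ?_)).trans ?_
    · split_ifs <;> simp
    · simp
  have hfin : ∀ j, ∑' i, ν {i} * queueStep r p i j ≠ ⊤ := fun j => by
    have h := lintegral_countable' (μ := ν) fun i => queueStep r p i j
    simp_rw [mul_comm (queueStep _ _ _ _)] at h
    rw [← h]
    refine ne_top_of_le_ne_top ENNReal.one_ne_top ((lintegral_mono fun i => hle i j).trans ?_)
    simp
  have hiff : IsStationaryQueue r p ν ↔
      ∀ j, ν.real {j} = (∑' i, ν {i} * queueStep r p i j).toReal :=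
    forall_congr' fun j => (ENNReal.toReal_eq_toReal_iff' (measure_ne_top _ _) (hfin j)).symm
  rw [hiff]
  constructor
  · intro h j
    -- Balance at `0` is the first flow equation; balance at `j + 1`, after substituting the flow
    -- equation at `j`, leaves the one at `j + 1`.
    induction j with
    | zero =>
      have := h 0
      rw [sum_queueStep_zero] at this
      rw [if_pos rfl]
      linarith
    | succ j ih =>
      have := h (j + 1)
      rw [sum_queueStep_succ, ih] at this
      rw [if_neg (Nat.succ_ne_zero j)]
      linarith
  · intro h j
    cases j with
    | zero =>
      have := h 0
      rw [if_pos rfl] at this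
      rw [sum_queueStep_zero]
      linarith
    | succ j =>
      have h1 := h (j + 1)
      rw [if_neg (Nat.succ_ne_zero j)] at h1
      rw [sum_queueStep_succ, h j]
      linarith

/-- Stationary distribution of the queue, with a geometric tail. -/
noncomputable def queueWeight (r p : ℝ) : ℕ → ℝ
  | 0 => 1 - r / p
  | j + 1 => (1 - r / p) * (r / (p * (1 - r))) * (r * (1 - p) / (p * (1 - r))) ^ j

theorem queueWeight_nonneg {r p : ℝ} (hr : 0 < r) (hrp : r < p) (hp : p ≤ 1) (j : ℕ) :
    0 ≤ queueWeight r p j := by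
  have hp0 : 0 < p := hr.trans hrp
  have h1 : 0 ≤ 1 - r / p := sub_nonneg.2 ((div_le_one hp0).2 hrp.le)
  have h2 : 0 ≤ 1 - r := by linarith
  have h3 : 0 ≤ 1 - p := by linarith
  cases j <;> unfold queueWeight <;> positivity

/-- The ratio of the geometric tail is below `1` because `r < p`. For `p = 1` it is `0`, and `0 ^ 0
= 1` leaves mass on `0` and `1` only. -/
theorem hasSum_queueWeight {r p : ℝ} (hr : 0 < r) (hrp : r < p) (hp : p ≤ 1) :
    HasSum (queueWeight r p) 1 := by
  have hp0 : 0 < p := hr.trans hrp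
  have hr1 : 0 < 1 - r := by linarith
  have hp1 : 0 ≤ 1 - p := by linarith
  have hlt : r * (1 - p) / (p * (1 - r)) < 1 := by
    rw [div_lt_one (by positivity)]; nlinarith
  have hg := (hasSum_geometric_of_lt_one (by positivity) hlt).mul_left
    ((1 - r / p) * (r / (p * (1 - r))))
  have hsum := (hasSum_nat_add_iff (f := queueWeight r p) 1).1 hg
  have h1 : p - r ≠ 0 := by linarith
  have h2 : 1 - r * (1 - p) / (p * (1 - r)) = (p - r) / (p * (1 - r)) := by
    field_simp; ring
  have h3 : (1 - r / p) * (r / (p * (1 - r))) * ((p - r) / (p * (1 - r)))⁻¹ + (1 - r / p) = 1 := by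
    field_simp
    ring
  rwa [Finset.sum_range_one, queueWeight, h2, h3] at hsum

theorem exists_isStationaryQueue {r p : unitInterval} (hr : 0 < (r : ℝ)) (hrp : (r : ℝ) < p) :
    ∃ ν : Measure ℕ, IsProbabilityMeasure ν ∧ IsStationaryQueue r p ν ∧
      ν.real {0} = 1 - r / p := by
  have hw := queueWeight_nonneg hr hrp p.2.2
  have hsum : HasSum (fun j => ENNReal.ofReal (queueWeight r p j)) 1 := by
    rw [ENNReal.summable.hasSum_iff, ← ENNReal.ofReal_tsum_of_nonneg hw
      (hasSum_queueWeight hr hrp p.2.2).summable, (hasSum_queueWeight hr hrp p.2.2).tsum_eq,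
      ENNReal.ofReal_one]
  let P : PMF ℕ := ⟨fun j => ENNReal.ofReal (queueWeight r p j), hsum⟩
  have hreal : ∀ j, P.toMeasure.real {j} = queueWeight r p j := fun j => by
    rw [Measure.real, PMF.toMeasure_apply_singleton _ _ (measurableSet_singleton j)]
    exact ENNReal.toReal_ofReal (hw j)
  refine ⟨P.toMeasure, inferInstance, (isStationaryQueue_iff r p _).2 fun j => ?_, hreal 0⟩
  have hp0 : 0 < (p : ℝ) := hr.trans hrp
  have hr1 : 1 - (r : ℝ) ≠ 0 := by linarith [p.2.2]
  rw [hreal, hreal]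
  cases j with
  | zero => simp only [queueWeight, if_true]; field_simp
  | succ j =>
    simp only [queueWeight, if_neg (Nat.succ_ne_zero j), pow_succ]; field_simp

/-- The flow equations form a first-order recursion, so two solutions are proportional, and equal
total masses make them equal. -/
theorem isStationaryQueue_unique {r p : unitInterval} (hr : 0 < (r : ℝ)) (hrp : (r : ℝ) < p)
    {ν μ : Measure ℕ} [IsProbabilityMeasure ν] [IsProbabilityMeasure μ]
    (hν : IsStationaryQueue r p ν) (hμ : IsStationaryQueue r p μ) (h0 : ν.real {0} ≠ 0) :
    μ = ν := by
  rw [isStationaryQueue_iff] at hν hμ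
  have hp0 : 0 < (p : ℝ) := hr.trans hrp
  have hr1 : 0 < 1 - (r : ℝ) := by linarith [p.2.2]
  have hpr : (p * (1 - r) : ℝ) ≠ 0 := by positivity
  have hprop : ∀ j, μ.real {j} * ν.real {0} = μ.real {0} * ν.real {j} := by
    intro j
    induction j with
    | zero => ring
    | succ j ih =>
      refine mul_right_cancel₀ hpr ?_
      rw [mul_right_comm, ← hμ j, mul_assoc (μ.real {0}), ← hν j, mul_right_comm, ih, mul_assoc]
  have hsmul : ENNReal.ofReal (ν.real {0}) • μ = ENNReal.ofReal (μ.real {0}) • ν := by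
    refine Measure.ext_of_singleton fun j => ?_
    rw [Measure.smul_apply, Measure.smul_apply, smul_eq_mul, smul_eq_mul, ← ofReal_measureReal,
      ← ofReal_measureReal (μ := ν) (s := {j}), ← ENNReal.ofReal_mul measureReal_nonneg,
      ← ENNReal.ofReal_mul measureReal_nonneg, mul_comm, hprop]
  -- Evaluation on the whole space identifies the two factors of proportionality.
  have heq : ENNReal.ofReal (ν.real {0}) = ENNReal.ofReal (μ.real {0}) := by
    have := congrArg (fun m : Measure ℕ => m Set.univ) hsmul
    simpa using this
  rw [← heq] at hsmul
  refine Measure.ext_of_singleton fun j => ?_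
  have := congrArg (fun m : Measure ℕ => m {j}) hsmul
  simp only [Measure.smul_apply, smul_eq_mul] at this
  exact (ENNReal.mul_right_inj (ENNReal.ofReal_pos.2 (measureReal_nonneg.lt_of_ne' h0)).ne'
    ENNReal.ofReal_ne_top).1 this

end Balance

/-! ### Stationary law of the observations and mean of the slot log-likelihood ratio -/

section Stationary

variable {E : Type*} [MeasurableSpace E]

theorem isStationaryQueue_iff_nextQueueLaw (r p : unitInterval) (g : Measure E)
    [IsProbabilityMeasure g] (ν : Measure ℕ) [IsProbabilityMeasure ν] :
    IsStationaryQueue r p ν ↔ nextQueueLaw r (emitLaw p g ν) = ν := by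
  rw [Measure.ext_iff_singleton]
  exact forall_congr' fun j => by rw [nextQueueLaw_emitLaw, eq_comm]

theorem invariant_emitLaw (r p : unitInterval) (g : Measure E) [IsProbabilityMeasure g]
    {ν : Measure ℕ} [IsProbabilityMeasure ν] (h : IsStationaryQueue r p ν) :
    Kernel.Invariant (transition r p g) (emitLaw p g ν) := by
  rw [Kernel.Invariant, bind_transition, (isStationaryQueue_iff_nextQueueLaw r p g ν).1 h]

/-- An invariant law equals its image under one transition, and every such image is an emission from
a queue law. -/
theorem eq_emitLaw_of_invariant {r p : unitInterval} {g : Measure E} [IsProbabilityMeasure g]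
    {m : Measure (Obs E)} [IsProbabilityMeasure m] (h : Kernel.Invariant (transition r p g) m) :
    m = emitLaw p g (nextQueueLaw r m) ∧ IsStationaryQueue r p (nextQueueLaw r m) := by
  rw [Kernel.Invariant, bind_transition] at h
  exact ⟨h.symm, (isStationaryQueue_iff_nextQueueLaw r p g _).2 (by rw [h])⟩

theorem measurable_slotLLR (p₀ p₁ : ℝ) (f₀ f₁ : Measure E) :
    Measurable (slotLLR p₀ p₁ f₀ f₁) := by
  refine Measurable.add ?_ (((measurable_llr f₁ f₀).sumElim measurable_const).comp
    measurable_snd.snd)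
  exact (measurable_of_countable fun u : ℕ × Service =>
    if 0 < u.1 then Real.log (serviceProb p₁ u.2 / serviceProb p₀ u.2) else 0).comp
      (f := fun s : Obs E => (s.1, s.2.1)) (by fun_prop)

/-- Separates queue length, channel state and measurement, which are independent under `emitLaw`, so
that the mean becomes a product. -/
theorem slotLLR_emit (p₀ p₁ : ℝ) (f₀ f₁ : Measure E) (t : ℕ × Bool × E) :
    slotLLR p₀ p₁ f₀ f₁ (emit t) = (if 0 < t.1 then 1 else 0) *
      ((if t.2.1 then Real.log (p₁ / p₀) else Real.log ((1 - p₁) / (1 - p₀))) +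
        (if t.2.1 then 1 else 0) * llr f₁ f₀ t.2.2) := by
  obtain ⟨q, c, x⟩ := t
  rcases Nat.eq_zero_or_pos q with rfl | h
  · simp [slotLLR, emit, serve, receive]
  · cases c <;> simp [slotLLR, emit, serve, receive, serviceProb, h, h.ne']

theorem integral_slotLLR_emitLaw (p₀ p : unitInterval) (f₀ f₁ : Measure E)
    [IsProbabilityMeasure f₀] [IsProbabilityMeasure f₁] (hf : klDiv f₁ f₀ ≠ ⊤) (ν : Measure ℕ)
    [IsProbabilityMeasure ν] :
    Integrable (slotLLR p₀ p f₀ f₁) (emitLaw p f₁ ν) ∧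
      ∫ s, slotLLR p₀ p f₀ f₁ s ∂(emitLaw p f₁ ν) =
        ν.real {q | 0 < q} * (bernoulliKL p p₀ + p * (klDiv f₁ f₀).toReal) := by
  obtain ⟨hac, hint⟩ := klDiv_ne_top_iff.1 hf
  have hm := measurable_slotLLR p₀ p f₀ f₁
  have hb : ∀ f : Bool → ℝ, Integrable f (bernoulliMeasure true false p) :=
    integrable_bernoulliMeasure _ _ _
  have h1 : Integrable (fun u : Bool × E => if u.1 then Real.log ((p : ℝ) / p₀)
      else Real.log ((1 - p) / (1 - p₀))) ((bernoulliMeasure true false p).prod f₁) :=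
    (hb fun c => if c then Real.log ((p : ℝ) / p₀) else Real.log ((1 - p) / (1 - p₀))).comp_fst f₁
  have h2 : Integrable (fun u : Bool × E => (if u.1 then 1 else 0 : ℝ) * llr f₁ f₀ u.2)
      ((bernoulliMeasure true false p).prod f₁) :=
    (hb fun c => if c then 1 else 0).mul_prod hint
  have h3 : Integrable (fun q : ℕ => (if 0 < q then 1 else 0 : ℝ)) ν :=
    Integrable.of_bound (measurable_of_countable _).aestronglyMeasurable 1
      (ae_of_all _ fun q => by split_ifs <;> simp)
  have hcomp : slotLLR p₀ p f₀ f₁ ∘ emit = fun t => (if 0 < t.1 then 1 else 0) *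
      ((if t.2.1 then Real.log ((p : ℝ) / p₀) else Real.log ((1 - p) / (1 - p₀))) +
        (if t.2.1 then 1 else 0) * llr f₁ f₀ t.2.2) :=
    funext fun t => slotLLR_emit p₀ p f₀ f₁ t
  constructor
  · rw [emitLaw, integrable_map_measure hm.aestronglyMeasurable measurable_emit.aemeasurable, hcomp]
    exact h3.mul_prod (h1.add h2)
  · have e1 : ∫ q, (if 0 < q then 1 else 0 : ℝ) ∂ν = ν.real {q | 0 < q} := by
      rw [← integral_indicator_one (MeasurableSet.of_discrete)]
      exact integral_congr_ae (ae_of_all _ fun q => by simp [Set.indicator_apply])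
    have e2 : ∫ u, (if u.1 then Real.log ((p : ℝ) / p₀) else Real.log ((1 - p) / (1 - p₀)))
        ∂((bernoulliMeasure true false p).prod f₁) = bernoulliKL p p₀ := by
      rw [integral_fun_fst (fun c : Bool =>
        if c then Real.log ((p : ℝ) / p₀) else Real.log ((1 - p) / (1 - p₀)))]
      simp [integral_bernoulliMeasure, bernoulliKL]
    have e3 : ∫ u, (if u.1 then 1 else 0 : ℝ) * llr f₁ f₀ u.2
        ∂((bernoulliMeasure true false p).prod f₁) = p * (klDiv f₁ f₀).toReal := by
      rw [integral_prod_mul (fun c : Bool => (if c then 1 else 0 : ℝ)) (llr f₁ f₀),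
        toReal_klDiv_of_measure_eq hac (by simp)]
      simp [integral_bernoulliMeasure]
    rw [emitLaw, integral_map measurable_emit.aemeasurable hm.aestronglyMeasurable]
    simp_rw [slotLLR_emit]
    rw [integral_prod_mul (fun q : ℕ => (if 0 < q then 1 else 0 : ℝ)) (fun u : Bool × E =>
      (if u.1 then Real.log ((p : ℝ) / p₀) else Real.log ((1 - p) / (1 - p₀))) +
        (if u.1 then 1 else 0) * llr f₁ f₀ u.2), integral_add h1 h2, e1, e2, e3]

theorem emitLaw_real_pos (p : unitInterval) (g : Measure E) [IsProbabilityMeasure g]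
    (ν : Measure ℕ) [IsProbabilityMeasure ν] :
    (emitLaw p g ν).real {s | 0 < s.1} = ν.real {q | 0 < q} := by
  have hs : MeasurableSet {s : Obs E | 0 < s.1} :=
    measurable_fst (MeasurableSet.of_discrete (s := {q : ℕ | 0 < q}))
  rw [emitLaw, map_measureReal_apply measurable_emit hs]
  have : emit ⁻¹' {s : Obs E | 0 < s.1} = {q : ℕ | 0 < q} ×ˢ Set.univ := by
    ext t; simp [emit]
  rw [this, measureReal_prod_prod]
  simp

end Stationary

end LossyLink

/-! ### The information rate -/

theorem mainTheorem3 {E : Type*} [MeasurableSpace E]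
    (f₀ f₁ : Measure E) [IsProbabilityMeasure f₀] [IsProbabilityMeasure f₁]
    (r p₀ p₁ : unitInterval) (hr : 0 < (r : ℝ)) (hr₀ : (r : ℝ) < p₀) (hr₁ : (r : ℝ) < p₁)
    (hp : (p₀ : ℝ) < 1 ∨ (p₁ : ℝ) = 1) (hf : klDiv f₁ f₀ ≠ ⊤) :
    ∃ stat : Measure (LossyLink.Obs E), IsProbabilityMeasure stat ∧
      Kernel.Invariant (LossyLink.transition r p₁ f₁) stat ∧
      (∀ m : Measure (LossyLink.Obs E), IsProbabilityMeasure m →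
        Kernel.Invariant (LossyLink.transition r p₁ f₁) m → m = stat) ∧
      Integrable (LossyLink.slotLLR p₀ p₁ f₀ f₁) stat ∧
      ∃ I : ℝ,
        (∀ q : ℕ, ∀ᵐ ω ∂(LossyLink.lawPost q r p₁ f₀ f₁),
          Tendsto (fun n : ℕ => (1 / (n : ℝ)) * LossyLink.logLikelihood q r p₀ p₁ f₀ f₁ n ω)
            atTop (𝓝 I)) ∧
        I = ∫ s, LossyLink.slotLLR p₀ p₁ f₀ f₁ s ∂stat ∧
        I = stat.real {s | 0 < s.1} *
          (LossyLink.bernoulliKL p₁ p₀ + p₁ * (klDiv f₁ f₀).toReal) ∧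
        stat.real {s | 0 < s.1} = r / p₁ ∧
        I = r * (LossyLink.bernoulliKL p₁ p₀ / p₁ + (klDiv f₁ f₀).toReal) := by
  obtain ⟨ν, hν, hstat, hν0⟩ := LossyLink.exists_isStationaryQueue hr hr₁
  have h1 : 0 < (p₁ : ℝ) := hr.trans hr₁
  obtain ⟨hint, hval⟩ := LossyLink.integral_slotLLR_emitLaw p₀ p₁ f₀ f₁ hf ν
  have hpos : ν.real {q | 0 < q} = r / p₁ := by
    have hc : {q : ℕ | 0 < q} = {0}ᶜ := by ext q; simp [Nat.pos_iff_ne_zero]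
    rw [hc, probReal_compl_eq_one_sub (measurableSet_singleton 0), hν0, sub_sub_cancel]
  have hI : (r : ℝ) * (LossyLink.bernoulliKL p₁ p₀ / p₁ + (klDiv f₁ f₀).toReal) =
      r / p₁ * (LossyLink.bernoulliKL p₁ p₀ + p₁ * (klDiv f₁ f₀).toReal) := by
    field_simp
  refine ⟨LossyLink.emitLaw p₁ f₁ ν, inferInstance, LossyLink.invariant_emitLaw r p₁ f₁ hstat,
    fun m hm hinv => ?_, hint, _,
    LossyLink.ae_tendsto_logLikelihood f₀ f₁ hr hr₀ hr₁ hp hf, ?_, ?_, ?_, rfl⟩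
  · obtain ⟨hm1, hm2⟩ := LossyLink.eq_emitLaw_of_invariant hinv
    rw [hm1, LossyLink.isStationaryQueue_unique hr hr₁ hstat hm2]
    -- The remaining side condition of uniqueness: the empty queue has mass `1 - r / p₁ ≠ 0`, by `r
    -- < p₁`.
    rw [hν0]
    exact (sub_pos.2 ((div_lt_one h1).2 hr₁)).ne'
  · rw [hval, hpos, hI]
  · rw [LossyLink.emitLaw_real_pos, hpos, hI]
  · rw [LossyLink.emitLaw_real_pos, hpos]
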